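/- **Setting.** Let $d\ge 2$, let $\gamma\ge 1$ be an integer and $K\ge 0$. A function $g:[0,1]^{d-1}\to\mathbb R$ is $(K,\gamma)$-Hölder smooth if it is $\gamma$ times continuously differentiable and $\bigl|g(y)-\sum_{|m|\le\gamma}\frac{\partial^m g(x)}{m!}(y-x)^m\bigr|\le K\|y-x\|^\gamma$ for all $x,y\in[0,1]^{d-1}$. Let $g^*:[0,1]^{d-1}\to[0,1]$ be $(K,\gamma)$-Hölder smooth; the true label of $(\tilde x,x_d)\in[0,1]^d$ is $\mathbf 1[x_d>g^*(\tilde x)]$. A labeler $L$ answers each query $x\in[0,1]^d$ by a fresh draw from a law $P(\cdot\mid x)$ on $\{0,1,\perp\}$. Write $\|g-g^*\|=\int_{[0,1]^{d-1}}|g-g^*|$. **Condition 1.** (a) If $|x_d-g^*(\tilde x)|\ge|x_d'-g^*(\tilde x)|$ then $P(\perp\mid(\tilde x,x_d))\le P(\perp\mid(\tilde x,x_d'))$; (b) $P(Y\ne\mathbf 1[x_d>g^*(\tilde x)]\mid x,\,Y\ne\perp)\le\frac12$. **Tests.** Let $[\ln\ln]_+(x)=\ln\ln\max\{x,e^e\}$,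 $V_n=\frac n{n-1}\bigl(\sum_{i\le n}X_i^2-\frac1n(\sum_{i\le n}X_i)^2\bigr)$, and $$p(n,\delta)=D_0\Bigl(1+\ln\tfrac1\delta+\sqrt{4n([\ln\ln]_+(4n)+\ln\tfrac1\delta)}\Bigr),$$ $$q(V,\delta)=D_1\Bigl(1+\ln\tfrac1\delta+\sqrt{(V+\ln\tfrac1\delta+1)([\ln\ln]_+(V+\ln\tfrac1\delta+1)+\ln\tfrac1\delta)}\Bigr).$$ Call $D_0$ admissible if for all i.i.d. centred $X_i\in[-2,2]$ and all $\delta\in(0,1)$, with probability at least $1-\delta$, $|\sum_{i\le n}X_i|\le p(n,\delta)$ for all $n\ge1$; call $D_1$ admissible if likewise $|\sum_{i\le n}X_i|\le q(V_n,\delta)$ for all $n\ge\max(1,\ln\frac1\delta)$. CheckSignificant$(X_1,\dots,X_n;\delta)$ is the test $\sum X_i\ge p(n,\delta)$; CheckSignificant-Var is the test "$n\ge\ln\frac1\delta$ and $\sum X_i\ge q(V_n,\delta)$". **Algorithm 1** (precision $\epsilon$, confidence $\delta$; on a line). Put $N=\lceil\log_{4/3}\frac1{2\epsilon}\rceil$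 and $[L_0,R_0]=[0,1]$. For $k=0,\dots,N-1$ put $U=\frac{3L_k+R_k}4$, $M=\frac{L_k+R_k}2$, $V=\frac{L_k+3R_k}4$; for $n=1,2,\dots$ query once at each of $U,M,V$. Let $A^{(w)}_i=1$ if the $i$-th response at $w$ is a label and $0$ otherwise, and let $B^{(w)}$ list the labels received at $w$ as $\pm1$. In this order, with level $\frac{\delta}{4N}$: if CheckSignificant-Var accepts $(A^{(u)}_i-A^{(m)}_i)_{i\le n}$, go on to the next $k$ with $[U,R_k]$; if it accepts $(A^{(v)}_i-A^{(m)}_i)_{i\le n}$, with $[L_k,V]$; if CheckSignificant accepts $-B^{(u)}$, with $[U,R_k]$; if it accepts $B^{(v)}$, with $[L_k,V]$. Output $(L_N+R_N)/2$. **Algorithm 2** (parameters $\epsilon,\delta,\gamma$ and $M\in\mathbb N$, $\gamma\mid M$). Let $\mathcal L=\{\frac0M,\frac1M,\dots,\frac MM\}^{d-1}$. For each $l\in\mathcal L$ run Algorithm 1 on the line $\{l\}\times[0,1]$ with precision $\epsilon$ and confidence $\delta/(M+1)^{d-1}$, to get $g_l$. For $q\in\{0,\dots,\frac M\gamma-1\}^{d-1}$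 put $I_q=\prod_i[\frac{q_i\gamma}M,\frac{(q_i+1)\gamma}M]$ and $g_q=\sum_{l\in I_q\cap\mathcal L}g_lQ_{q,l}$, where $$Q_{q,l}(\tilde x)=\prod_{i=1}^{d-1}\ \prod_{0\le j\le\gamma,\ j\ne Ml_i-\gamma q_i}\frac{\tilde x_i-(\gamma q_i+j)/M}{l_i-(\gamma q_i+j)/M}.$$ Output $g=\sum_q g_q\mathbf 1_{I_q}$. The algorithm stops if all runs of Algorithm 1 stop. **Theorem.** Admissible constants $D_0$ and $D_1$ exist. Moreover: 1. For every $a>0$ there is $C>0$, depending only on $d,\gamma,K,a$, such that for all admissible $D_0,D_1$, all $\epsilon\in(0,\frac12]$, $\delta\in(0,1)$, all $M\ge a\epsilon^{-1/\gamma}$ with $\gamma\mid M$, all $g^*$ as above and all labelers satisfying Condition 1: with probability at least $1-\frac\delta2$, if Algorithm 2 stops, its output satisfies $\|g-g^*\|\le C\epsilon$. 2. There are $c\in(0,1]$ and $a>0$, depending only on $d,\gamma,K$, such that under the same assumptions, with $M\ge a\epsilon^{-1/\gamma}$ and with the runs of Algorithm 1 at precision $c\epsilon$: with probability at least $1-\frac\delta2$,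 if Algorithm 2 stops, its output satisfies $\|g-g^*\|\le\epsilon$. -/

import Mathlib

open MeasureTheory Set
open scoped ENNReal

namespace AbstainingLabeler

noncomputable section

/-! ## Smooth boundaries, labelers, and the condition on the labeler -/

/-- The unit cube `[0,1]^m`. -/
def cube (m : ℕ) : Set (Fin m → ℝ) := Icc 0 1

/-- The Euclidean norm on `ℝ^m`. -/
def eucl {m : ℕ} (v : Fin m → ℝ) : ℝ := ‖WithLp.toLp 2 v‖

/-- `g` is `(K, γ)`-Hölder smooth on `[0,1]^m`: it is `⌊γ⌋` times continuously differentiable there,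
and its Taylor polynomial of order `⌊γ⌋` at `x` is within `K ‖y - x‖ ^ γ` of `g y`.
The `k`-th homogeneous Taylor term is the `k`-th derivative on the diagonal, divided by `k!`. -/
def HolderSmooth {m : ℕ} (K γ : ℝ) (g : (Fin m → ℝ) → ℝ) : Prop :=
  ContDiffOn ℝ (⌊γ⌋₊ : ℕ) g (cube m) ∧
    ∀ x ∈ cube m, ∀ y ∈ cube m,
      |g y - ∑ k ∈ Finset.range (⌊γ⌋₊ + 1),
          (1 / (k.factorial : ℝ)) * iteratedFDerivWithin ℝ k g (cube m) x (fun _ => y - x)|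
        ≤ K * eucl (y - x) ^ γ

/-- The boundaries of the smooth boundary fragment class: Hölder smooth, with values in `[0,1]`. -/
def SmoothBoundary {m : ℕ} (K γ : ℝ) (g : (Fin m → ℝ) → ℝ) : Prop :=
  HolderSmooth K γ g ∧ ∀ x ∈ cube m, g x ∈ Icc (0 : ℝ) 1

/-- The `L¹` distance of two boundaries on `[0,1]^m`. -/
def l1Dist {m : ℕ} (g h : (Fin m → ℝ) → ℝ) : ℝ≥0∞ :=
  ∫⁻ x in cube m, ENNReal.ofReal |g x - h x|

/-- A response of the labeler: one of the two labels, or an abstention. -/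
inductive Response
  | zero
  | one
  | abstain
  deriving DecidableEq

instance : MeasurableSpace Response := ⊤

/-- A labeler on `[0,1]^(m+1)`: `L x t` is the law of the response to a query at `(x, t)`,
where `x` collects the first `m` coordinates and `t` is the last one. -/
abbrev Labeler (m : ℕ) : Type := (Fin m → ℝ) → ℝ → PMF Response

/-- The ground truth label of `(x, t)`: the indicator of `t > g x`. -/
def trueLabel {m : ℕ} (g : (Fin m → ℝ) → ℝ) (x : Fin m → ℝ) (t : ℝ) : Response :=
  open Classical in if g x < t then Response.one else Response.zero

/-- The abstention probability does not decrease towards the boundary `g`, and, given that the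
labeler answers, the answer is wrong with probability at most `1/2`. (Where the labeler abstains
almost surely, `ProbabilityTheory.cond` is the zero measure and the second part says nothing.) -/
structure LabelerCondition {m : ℕ} (g : (Fin m → ℝ) → ℝ) (L : Labeler m) : Prop where
  abstention : ∀ x ∈ cube m, ∀ t ∈ Icc (0 : ℝ) 1, ∀ t' ∈ Icc (0 : ℝ) 1,
    |t' - g x| ≤ |t - g x| → L x t Response.abstain ≤ L x t' Response.abstain
  noise : ∀ x ∈ cube m, ∀ t ∈ Icc (0 : ℝ) 1,
    ProbabilityTheory.cond (L x t).toMeasure {y | y ≠ Response.abstain}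
      {y | y ≠ trueLabel g x t} ≤ 1 / 2

/-! ## Adaptive sequential testing -/

/-- `ln ln max {x, e^e}`. -/
def lnlnPlus (x : ℝ) : ℝ := Real.log (Real.log (max x (Real.exp (Real.exp 1))))

/-- The threshold `p(n, δ)`. -/
def pThreshold (D₀ : ℝ) (n : ℕ) (δ : ℝ) : ℝ :=
  D₀ * (1 + Real.log (1 / δ) + √(4 * n * (lnlnPlus (4 * n) + Real.log (1 / δ))))

/-- The threshold `q(n, Var, δ)`, which depends on `n` only through `Var`. -/
def qThreshold (D₁ V δ : ℝ) : ℝ :=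
  D₁ * (1 + Real.log (1 / δ) +
    √((V + Real.log (1 / δ) + 1) * (lnlnPlus (V + Real.log (1 / δ) + 1) + Real.log (1 / δ))))

/-- The empirical variance `n/(n-1) (∑ Xᵢ² - (∑ Xᵢ)²/n)`. -/
def empVar (X : List ℝ) : ℝ :=
  (X.length : ℝ) / ((X.length : ℝ) - 1) *
    ((X.map (fun a => a ^ 2)).sum - 1 / (X.length : ℝ) * X.sum ^ 2)

def CheckSignificant (D₀ : ℝ) (X : List ℝ) (δ : ℝ) : Prop :=
  pThreshold D₀ X.length δ ≤ X.sum

def CheckSignificantVar (D₁ : ℝ) (X : List ℝ) (δ : ℝ) : Prop :=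
  Real.log (1 / δ) ≤ X.length ∧ qThreshold D₁ (empVar X) δ ≤ X.sum

/-- The list of the first `n` terms of a sequence. -/
def firstTerms (x : ℕ → ℝ) (n : ℕ) : List ℝ := (List.range n).map x

/-- `ν` is a centred probability law on `[-2,2]`. -/
structure CentredLaw (ν : Measure ℝ) : Prop where
  prob : IsProbabilityMeasure ν
  bounded : ν (Icc (-2 : ℝ) 2)ᶜ = 0
  mean_zero : ∫ x, x ∂ν = 0

/-- `D₀` is an admissible constant for the uniform concentration inequality behind
`CheckSignificant`: if `X₁, X₂, …` are i.i.d. and centred with values in `[-2,2]`, then with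
probability at least `1 - δ`, `|X₁ + ⋯ + Xₙ| ≤ p(n, δ)` for all `n > 0` simultaneously. -/
def UniformBernstein (D₀ : ℝ) : Prop :=
  ∀ (ν : Measure ℝ), CentredLaw ν → ∀ δ : ℝ, 0 < δ → δ < 1 →
    ENNReal.ofReal (1 - δ) ≤ Measure.infinitePi (fun _ : ℕ => ν)
      {x | ∀ n : ℕ, 0 < n → |(firstTerms x n).sum| ≤ pThreshold D₀ n δ}

/-- `D₁` is an admissible constant for the uniform empirical concentration inequality behind
`CheckSignificantVar`: for i.i.d. variables as above, with probability at least `1 - δ`,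
`|X₁ + ⋯ + Xₙ| ≤ q(n, Vₙ, δ)` for all `n ≥ ln (1/δ)` simultaneously. -/
def UniformEmpiricalBernstein (D₁ : ℝ) : Prop :=
  ∀ (ν : Measure ℝ), CentredLaw ν → ∀ δ : ℝ, 0 < δ → δ < 1 →
    ENNReal.ofReal (1 - δ) ≤ Measure.infinitePi (fun _ : ℕ => ν)
      {x | ∀ n : ℕ, 0 < n → Real.log (1 / δ) ≤ n →
        |(firstTerms x n).sum| ≤ qThreshold D₁ (empVar (firstTerms x n)) δ}

/-! ## The one-dimensional algorithm -/

/-- The names of the three quartiles `U`, `M`, `V` of an interval. -/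
inductive Quartile
  | u
  | m
  | v
  deriving DecidableEq

/-- The position of a quartile in the interval `[L, R] = [I.1, I.2]`. -/
def Quartile.pos (I : ℝ × ℝ) : Quartile → ℝ
  | .u => (3 * I.1 + I.2) / 4
  | .m => (I.1 + I.2) / 2
  | .v => (I.1 + 3 * I.2) / 4

/-- The entry of the array `A` for a response: `1` for a label, `0` for an abstention. -/
def aEntry : Response → ℝ
  | .abstain => 0
  | _ => 1

/-- The entry (if any) of the array `B` for a response: a label as `-1/1`, no entry for an
abstention. -/
def bEntry : Response → Option ℝ
  | .zero => some (-1)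
  | .one => some 1
  | .abstain => none

/-- The differences `A⁽ʷ⁾ᵢ - A⁽ᵐ⁾ᵢ` after `n` repetitions; `X i w` is the response of quartile `w` in
repetition `i`. -/
def aDiff (X : ℕ → Quartile → Response) (w : Quartile) (n : ℕ) : List ℝ :=
  (List.range n).map (fun i => aEntry (X i w) - aEntry (X i .m))

/-- The array `B⁽ʷ⁾` after `n` repetitions. -/
def bArray (X : ℕ → Quartile → Response) (w : Quartile) (n : ℕ) : List ℝ :=
  (List.range n).filterMap (fun i => bEntry (X i w))

open Classical in
/-- The tests made after `n` repetitions, in order: the next interval, or `none` if no test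
succeeds. -/
def decision (D₀ D₁ δ : ℝ) (I : ℝ × ℝ) (X : ℕ → Quartile → Response) (n : ℕ) : Option (ℝ × ℝ) :=
  if CheckSignificantVar D₁ (aDiff X .u n) δ then some (Quartile.pos I .u, I.2)
  else if CheckSignificantVar D₁ (aDiff X .v n) δ then some (I.1, Quartile.pos I .v)
  else if CheckSignificant D₀ ((bArray X .u n).map (fun b => -b)) δ then
    some (Quartile.pos I .u, I.2)
  else if CheckSignificant D₀ (bArray X .v n) δ then some (I.1, Quartile.pos I .v)
  else none

open Classical in
/-- One iteration of the outer loop: repeat for `n = 1, 2, …` until a test succeeds; `none` if this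
never happens. -/
def roundStep (D₀ D₁ δ : ℝ) (I : ℝ × ℝ) (X : ℕ → Quartile → Response) : Option (ℝ × ℝ) :=
  if h : ∃ n : ℕ, 1 ≤ n ∧ (decision D₀ D₁ δ I X n).isSome then
    decision D₀ D₁ δ I X (Nat.find h)
  else none

/-- The number of iterations, `log_{4/3} (1/(2ε))`, rounded up if it is not an integer. -/
def numRounds (ε : ℝ) : ℕ := ⌈Real.logb (4 / 3) (1 / (2 * ε))⌉₊

/-- The interval after `k` iterations, with `none` for non-termination. `Y k i w t` is the response
to the query made in iteration `k`, repetition `i`, for quartile `w`, when this query is at `t`.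
`δ'` is the confidence level of each test. -/
def intervalAfter (D₀ D₁ δ' : ℝ) (Y : ℕ → ℕ → Quartile → ℝ → Response) : ℕ → Option (ℝ × ℝ)
  | 0 => some (0, 1)
  | k + 1 => (intervalAfter D₀ D₁ δ' Y k).bind (fun I =>
      roundStep D₀ D₁ δ' I (fun i w => Y k i w (Quartile.pos I w)))

/-- The algorithm for thresholds with precision `ε` and confidence `δ`: the midpoint of the last
interval, or `none` if the algorithm does not stop. -/
def learnThreshold (D₀ D₁ ε δ : ℝ) (Y : ℕ → ℕ → Quartile → ℝ → Response) : Option ℝ :=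
  (intervalAfter D₀ D₁ (δ / (4 * (numRounds ε : ℝ))) Y (numRounds ε)).map
    (fun I => (I.1 + I.2) / 2)

/-! ## The multidimensional algorithm -/

/-- The grid `{0, …, M}^m`; the index `l` stands for the point `l / M`. -/
abbrev Grid (m M : ℕ) : Type := Fin m → Fin (M + 1)

/-- The point of `[0,1]^m` of a grid index. -/
def gridPoint {m M : ℕ} (l : Grid m M) : Fin m → ℝ := fun i => ((l i : ℕ) : ℝ) / (M : ℝ)

/-- The cell `I_q = ∏ᵢ [qᵢ γ / M, (qᵢ + 1) γ / M]`. -/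
def cell {m M : ℕ} (γ : ℕ) (q : Fin m → Fin (M / γ)) : Set (Fin m → ℝ) :=
  Icc (fun i => ((q i : ℕ) : ℝ) * γ / M) (fun i => (((q i : ℕ) : ℝ) + 1) * γ / M)

/-- The tensor-product Lagrange polynomial `Q_{q,l}`. -/
def lagrangeQ {m M : ℕ} (γ : ℕ) (q : Fin m → Fin (M / γ)) (l : Grid m M) (x : Fin m → ℝ) : ℝ :=
  ∏ i, ∏ j ∈ (Finset.range (γ + 1)).filter (fun j => γ * (q i : ℕ) + j ≠ (l i : ℕ)),
    (x i - ((γ * (q i : ℕ) + j : ℕ) : ℝ) / M) /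
      (gridPoint l i - ((γ * (q i : ℕ) + j : ℕ) : ℝ) / M)

open Classical in
/-- The interpolating polynomial of the cell `I_q`, for the values `v` on the grid. -/
def cellPoly {m M : ℕ} (γ : ℕ) (v : Grid m M → ℝ) (q : Fin m → Fin (M / γ))
    (x : Fin m → ℝ) : ℝ :=
  ∑ l ∈ Finset.univ.filter (fun l : Grid m M => gridPoint l ∈ cell γ q), v l * lagrangeQ γ q l x

/-- The piecewise tensor-polynomial interpolation of the values `v` on the grid. -/
def interpolate {m M : ℕ} (γ : ℕ) (v : Grid m M → ℝ) (x : Fin m → ℝ) : ℝ :=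
  ∑ q : Fin m → Fin (M / γ), (cell γ q).indicator (cellPoly γ v q) x

/-- A query slot: the grid line, the iteration, the repetition, the quartile, and the position of
the query on the line. -/
abbrev Slot (m M : ℕ) : Type := Grid m M × ℕ × ℕ × Quartile × ℝ

/-- The law of the responses: all slots are independent, and the response in a slot at position
`t` of the line `l` has the law `L (l/M) t`. For each line, iteration, repetition and quartile the
algorithm makes one query, so it uses one position only, which is determined by responses of
earlier iterations. Hence each query it makes gets a fresh response that, given all the earlier
responses, is drawn from the law that the labeler has at the queried point. -/
def responseLaw {m : ℕ} (M : ℕ) (L : Labeler m) : Measure (Slot m M → Response) :=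
  Measure.infinitePi (fun s : Slot m M => (L (gridPoint s.1) s.2.2.2.2).toMeasure)

open Classical in
/-- The algorithm for smooth boundary fragments: on each of the `(M + 1)^m` grid lines, learn a
threshold with precision `ε` and confidence `δ / (M + 1)^m`; then interpolate. The output is `none`
if one of these runs does not stop. -/
def learnBoundary {m : ℕ} (D₀ D₁ : ℝ) (γ M : ℕ) (ε δ : ℝ) (ω : Slot m M → Response) :
    Option ((Fin m → ℝ) → ℝ) :=
  let run : Grid m M → Option ℝ := fun l =>
    learnThreshold D₀ D₁ ε (δ / ((M : ℝ) + 1) ^ m) (fun k i w t => ω (l, k, i, w, t))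
  if h : ∀ l, (run l).isSome then some (interpolate γ (fun l => (run l).get (h l))) else none

/-- With probability at least `1 - δ/2` over the responses of `L`, the algorithm, run on the grid of
mesh `1/M` with precision `ε` and confidence `δ`, has no output `g` with `‖g - gstar‖ > η`. -/
def OutputWithin {m : ℕ} (D₀ D₁ : ℝ) (γ M : ℕ) (ε δ : ℝ) (L : Labeler m)
    (gstar : (Fin m → ℝ) → ℝ) (η : ℝ) : Prop :=
  ENNReal.ofReal (1 - δ / 2) ≤ responseLaw M L
    {ω | ∀ g, learnBoundary D₀ D₁ γ M ε δ ω = some g → l1Dist g gstar ≤ ENNReal.ofReal η}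

end

end AbstainingLabeler

open AbstainingLabeler

/-! The argument has a probabilistic half, in which every run of Algorithm 1 that stops is within
its precision of the boundary on its line, and a deterministic half, in which interpolating nearly
correct values of a smooth function gives nearly the function. No bound on the number of queries is
needed, since nothing is claimed about runs that do not stop.

Admissible constants come from one self-normalised bound, `CentredLaw.self_normalised`. For |y| ≤
1/2 one has exp(y - y²) ≤ 1 + y, so for |a| ≤ 1/4 the products of exp(a Xᵢ - a² Xᵢ²) form a
nonnegative supermartingale, and Ville's inequality bounds the chance that a ∑ Xᵢ ever exceeds a² ∑
Xᵢ² + ln(1/δ). Stitching the slopes ±2⁻ᵏ/4 with weights 1/((k+1)(k+2)) turns these lines into a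
curve of iterated-logarithm type in W = ∑ Xᵢ². For p, W ≤ 4n suffices. For q, W must be compared
with the empirical variance, and the restriction n ≥ ln(1/δ) handles the case in which W is much
larger.

A round loses the boundary only if a test accepts although its variables have nonpositive mean. For
the abstention tests this is Condition 1(a), as the quartile on the boundary's side is at least as
close to it as the midpoint. For the label tests it is Condition 1(b), after conditioning on which
queries are answered. At most two tests can do harm in a round, so a line fails with probability at
most N · 2 · δ/(4N) = δ/2 at its own level δ (`measure_lineFailure_le`). The queries are adaptive,
but only finitely many intervals can occur after k rounds, and round k is independent of which of
them did (`measure_lostAt_le`). A union bound over the lines finishes this half.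

For the interpolation, fix x in a cell and take the Taylor polynomial of the boundary centred at x
itself. Its degree is at most γ, so tensor Lagrange interpolation reproduces it, and its value at x
is the boundary's value. The error at x is then a sum over the nodes of line error plus Taylor
remainder, times bounded Lagrange weights (`abs_cellPoly_sub_le`). The remainder is of order M^(-γ),
hence O(ε) when M ≥ a ε^(-1/γ). -/

namespace AbstainingLabeler

noncomputable section

/-! ## A maximal inequality for products of i.i.d. variables -/

/-- The event that none of the partial products up to time `N` reaches the level `c`. -/
def staysBelow (f : ℝ → ℝ≥0∞) (c : ℝ≥0∞) (N : ℕ) : Set (ℕ → ℝ) :=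
  {x | ∀ n ≤ N, ∏ i ∈ Finset.range n, f (x i) < c}

/-- The σ-algebra of the coordinates before `N`. -/
abbrev sigmaBefore (N : ℕ) : MeasurableSpace (ℕ → ℝ) :=
  ⨆ i ∈ Iio N, MeasurableSpace.comap (fun x : ℕ → ℝ => x i) inferInstance

lemma measurable_partialProd {f : ℝ → ℝ≥0∞} (hf : Measurable f) {n N : ℕ} (h : n ≤ N) :
    Measurable[sigmaBefore N] (fun x : ℕ → ℝ => ∏ i ∈ Finset.range n, f (x i)) := by
  refine Finset.measurable_fun_prod _ fun i hi => hf.comp ?_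
  have hle : MeasurableSpace.comap (fun x : ℕ → ℝ => x i) inferInstance ≤ sigmaBefore N :=
    le_iSup₂_of_le i (lt_of_lt_of_le (Finset.mem_range.1 hi) h) le_rfl
  exact Measurable.mono (comap_measurable (fun x : ℕ → ℝ => x i)) hle le_rfl

lemma measurableSet_staysBelow {f : ℝ → ℝ≥0∞} (hf : Measurable f) (c : ℝ≥0∞) (N : ℕ) :
    MeasurableSet[sigmaBefore N] (staysBelow f c N) := by
  have : staysBelow f c N = ⋂ n ∈ Finset.range (N + 1),
      {x | ∏ i ∈ Finset.range n, f (x i) < c} := by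
    ext x; simp [staysBelow]
  rw [this]
  refine Finset.measurableSet_biInter _ fun n hn => ?_
  exact measurableSet_lt (measurable_partialProd hf (Nat.lt_succ_iff.1 (Finset.mem_range.1 hn)))
    measurable_const

lemma sigmaBefore_le (N : ℕ) : sigmaBefore N ≤ MeasurableSpace.pi :=
  iSup₂_le fun i _ => (measurable_pi_apply i).comap_le

/-- The supermartingale step: the coordinate N is independent of everything before it, so the next
factor integrates out. -/
lemma lintegral_mul_next {ν : Measure ℝ} [IsProbabilityMeasure ν] {f : ℝ → ℝ≥0∞}
    (hf : Measurable f) {N : ℕ} {h : (ℕ → ℝ) → ℝ≥0∞} (hh : Measurable[sigmaBefore N] h) :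
    ∫⁻ x, h x * f (x N) ∂Measure.infinitePi (fun _ : ℕ => ν)
      = (∫⁻ x, h x ∂Measure.infinitePi (fun _ : ℕ => ν)) * ∫⁻ y, f y ∂ν := by
  have hind := (ProbabilityTheory.iIndepFun_infinitePi (P := fun _ : ℕ => ν)
    (X := fun _ : ℕ => (id : ℝ → ℝ)) (fun _ => measurable_id)).iIndep
  have hind2 := ProbabilityTheory.indep_iSup_of_disjoint
    (fun i => (measurable_pi_apply i).comap_le) hind
    (S := Iio N) (T := {N}) (by simp)
  rw [iSup_singleton] at hind2
  refine (ProbabilityTheory.lintegral_mul_eq_lintegral_mul_lintegral_of_independent_measurableSpace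
    (sigmaBefore_le N) ((measurable_pi_apply N).comap_le) hind2 hh
    (hf.comp (comap_measurable _))).trans ?_
  congr 1
  have := lintegral_map (μ := Measure.infinitePi (fun _ : ℕ => ν)) hf (measurable_pi_apply N)
  rw [Measure.infinitePi_map_eval] at this
  exact this.symm

/-- Optional stopping written as an invariant that is inductive in N. The first term is the mass
still running, the second charges c for every path that has already reached c, and the total never
increases. -/
lemma setLIntegral_staysBelow_add_le {ν : Measure ℝ} [IsProbabilityMeasure ν] {f : ℝ → ℝ≥0∞}
    (hf : Measurable f) (h1 : ∫⁻ y, f y ∂ν ≤ 1) {c : ℝ≥0∞} (hc : 1 < c)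
    (N : ℕ) :
    (∫⁻ x in staysBelow f c N, ∏ i ∈ Finset.range N, f (x i)
        ∂Measure.infinitePi (fun _ : ℕ => ν))
      + c * Measure.infinitePi (fun _ : ℕ => ν) (staysBelow f c N)ᶜ ≤ 1 := by
  set P := Measure.infinitePi (fun _ : ℕ => ν)
  have hm : ∀ n, MeasurableSet (staysBelow f c n) := fun n =>
    sigmaBefore_le n _ (measurableSet_staysBelow hf c n)
  have hmp : ∀ n, Measurable (fun x : ℕ → ℝ => ∏ i ∈ Finset.range n, f (x i)) := fun n =>
    (measurable_partialProd hf le_rfl).mono (sigmaBefore_le n) le_rfl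
  induction N with
  | zero =>
    have : staysBelow f c 0 = univ := by ext x; simp [staysBelow, hc]
    simp [this]
  | succ N ih =>
    refine le_trans ?_ ih
    set A := staysBelow f c N
    set A' := staysBelow f c (N + 1)
    have hA' : A' = A ∩ {x | ∏ i ∈ Finset.range (N + 1), f (x i) < c} := by
      ext x
      simp only [A', A, staysBelow, mem_ofPred_eq, mem_inter_iff]
      constructor
      · exact fun h => ⟨fun n hn => h n (by omega), h _ le_rfl⟩
      · rintro ⟨h, h'⟩ n hn
        rcases Nat.lt_or_ge n (N + 1) with hn' | hn'
        · exact h n (by omega)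
        · obtain rfl : n = N + 1 := by omega
          exact h'
    have hsub : A' ⊆ A := hA' ▸ inter_subset_left
    have hcompl : A'ᶜ = Aᶜ ∪ (A \ A') := by
      ext x
      have := @hsub x
      simp only [mem_compl_iff, mem_union, mem_sdiff]
      tauto
    have hstep : ∫⁻ x in A, ∏ i ∈ Finset.range (N + 1), f (x i) ∂P
        ≤ ∫⁻ x in A, ∏ i ∈ Finset.range N, f (x i) ∂P := by
      simp only [Finset.prod_range_succ]
      rw [← lintegral_indicator (hm N), ← lintegral_indicator (hm N)]
      have := lintegral_mul_next (ν := ν) hf (N := N)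
        (h := A.indicator fun x => ∏ i ∈ Finset.range N, f (x i))
        (Measurable.indicator (measurable_partialProd hf le_rfl) (measurableSet_staysBelow hf c N))
      calc _ = ∫⁻ x, (A.indicator (fun x => ∏ i ∈ Finset.range N, f (x i)) x) * f (x N) ∂P := by
            refine lintegral_congr fun x => ?_
            by_cases hx : x ∈ A
            · rw [indicator_of_mem hx, indicator_of_mem hx]
            · rw [indicator_of_notMem hx, indicator_of_notMem hx, zero_mul]
        _ ≤ _ := by rw [this]; exact mul_le_of_le_one_right' h1
    -- A path that leaves at time N + 1 has product at least c there, which pays for its charge.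
    have hsplit : (∫⁻ x in A', ∏ i ∈ Finset.range (N + 1), f (x i) ∂P) + c * P (A \ A')
        ≤ ∫⁻ x in A, ∏ i ∈ Finset.range (N + 1), f (x i) ∂P := by
      have h3 := lintegral_inter_add_sdiff (μ := P)
        (fun x : ℕ → ℝ => ∏ i ∈ Finset.range (N + 1), f (x i)) A (hm (N + 1))
      rw [← h3, inter_eq_self_of_subset_right hsub]
      gcongr
      rw [← setLIntegral_const]
      refine setLIntegral_mono (hmp _) fun x hx => ?_
      rw [hA'] at hx
      simp only [mem_sdiff, mem_inter_iff, mem_ofPred_eq] at hx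
      exact not_lt.1 fun h => hx.2 ⟨hx.1, h⟩
    calc _ ≤ (∫⁻ x in A', ∏ i ∈ Finset.range (N + 1), f (x i) ∂P)
          + c * (P Aᶜ + P (A \ A')) := by
            rw [hcompl]; gcongr; exact measure_union_le _ _
      _ = ((∫⁻ x in A', ∏ i ∈ Finset.range (N + 1), f (x i) ∂P) + c * P (A \ A'))
          + c * P Aᶜ := by rw [mul_add]; ring
      _ ≤ _ := by gcongr; exact hsplit.trans hstep

/-- Ville's inequality for products of i.i.d. nonnegative variables of mean at most one. -/
lemma mul_measure_exists_le_prod_le {ν : Measure ℝ} [IsProbabilityMeasure ν] {f : ℝ → ℝ≥0∞}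
    (hf : Measurable f) (h1 : ∫⁻ y, f y ∂ν ≤ 1) (c : ℝ≥0∞) :
    c * Measure.infinitePi (fun _ : ℕ => ν) {x | ∃ n, c ≤ ∏ i ∈ Finset.range n, f (x i)} ≤ 1 := by
  set P := Measure.infinitePi (fun _ : ℕ => ν)
  rcases le_or_gt c 1 with hc | hc
  · exact mul_le_one' hc prob_le_one
  have hU : {x : ℕ → ℝ | ∃ n, c ≤ ∏ i ∈ Finset.range n, f (x i)}
      = ⋃ N, (staysBelow f c N)ᶜ := by
    ext x
    simp only [staysBelow, mem_ofPred_eq, mem_iUnion, mem_compl_iff, not_forall, not_lt]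
    exact ⟨fun ⟨n, hn⟩ => ⟨n, n, le_rfl, hn⟩, fun ⟨_, n, _, hn⟩ => ⟨n, hn⟩⟩
  have hmono : Monotone fun N => (staysBelow f c N)ᶜ := fun N N' h => by
    refine compl_subset_compl.2 fun x hx n hn => hx n (hn.trans h)
  rw [hU, hmono.measure_iUnion, ENNReal.mul_iSup]
  refine iSup_le fun N => ?_
  exact le_add_self.trans (setLIntegral_staysBelow_add_le hf h1 hc N)

/-! ## Self-normalised concentration -/

/-- For y ≥ 0 this is log(1 + y) ≥ y/(1 + y) ≥ y - y². For y < 0 the quadratic lower bound of exp(-y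
+ y²), multiplied by 1 + y, is 1 + (y²/2)(1 + y - y² + y³). -/
lemma exp_sub_sq_le {y : ℝ} (hy : |y| ≤ 1 / 2) : Real.exp (y - y ^ 2) ≤ 1 + y := by
  obtain ⟨h1, h2⟩ := abs_le.1 hy
  rw [← Real.le_log_iff_exp_le (by linarith)]
  rcases le_or_gt 0 y with h | h
  · refine le_trans ?_ (Real.one_sub_inv_le_log_of_pos (by linarith))
    rw [le_sub_iff_add_le, ← le_sub_iff_add_le', inv_le_iff_one_le_mul₀ (by linarith)]
    nlinarith [mul_nonneg h (sq_nonneg y)]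
  · have hq := Real.quadratic_le_exp_of_nonneg (x := -y + y ^ 2) (by nlinarith)
    have h3 : (1 + y) * Real.exp (-y + y ^ 2) ≥ 1 := by
      refine le_trans ?_ (mul_le_mul_of_nonneg_left hq (by linarith))
      have h4 : 0 ≤ 1 + y - y ^ 2 + y ^ 3 := by nlinarith [mul_nonneg (sq_nonneg y) (sub_nonneg.2 h1)]
      nlinarith [mul_nonneg (sq_nonneg y) h4]
    rw [Real.le_log_iff_exp_le (by linarith)]
    have h5 : Real.exp (y - y ^ 2) * Real.exp (-y + y ^ 2) = 1 := by
      rw [← Real.exp_add]; simp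
    nlinarith [Real.exp_pos (-y + y ^ 2)]

lemma CentredLaw.ae_abs_le {ν : Measure ℝ} (hν : CentredLaw ν) : ∀ᵐ x ∂ν, |x| ≤ 2 := by
  filter_upwards [mem_ae_iff.2 hν.bounded] with x hx using abs_le.2 hx

/-- The compensator is a²x² rather than a variance, so that no second moment enters. The range 1/4
for a makes |a x| ≤ 1/2 on [-2,2]. -/
lemma CentredLaw.lintegral_exp_le {ν : Measure ℝ} (hν : CentredLaw ν) {a : ℝ} (ha : |a| ≤ 1 / 4) :
    ∫⁻ x, ENNReal.ofReal (Real.exp (a * x - a ^ 2 * x ^ 2)) ∂ν ≤ 1 := by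
  have := hν.prob
  have hb := hν.ae_abs_le
  have hax : ∀ᵐ x ∂ν, |a * x| ≤ 1 / 2 := by
    filter_upwards [hb] with x hx
    rw [abs_mul]; nlinarith [abs_nonneg a, abs_nonneg x]
  have hint : Integrable (fun x : ℝ => 1 + a * x) ν := by
    refine Integrable.add (integrable_const 1) (Integrable.const_mul ?_ a)
    exact Integrable.of_bound measurable_id.aestronglyMeasurable 2
      (by filter_upwards [hb] with x hx using hx)
  calc _ ≤ ∫⁻ x, ENNReal.ofReal (1 + a * x) ∂ν := by
        refine lintegral_mono_ae ?_
        filter_upwards [hax] with x hx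
        rw [← mul_pow]
        exact ENNReal.ofReal_le_ofReal (exp_sub_sq_le hx)
    _ = ENNReal.ofReal (∫ x, 1 + a * x ∂ν) := by
        rw [ofReal_integral_eq_lintegral_ofReal hint]
        filter_upwards [hax] with x hx
        have := (abs_le.1 hx).1
        simp only [Pi.zero_apply]; linarith
    _ ≤ 1 := by
        rw [integral_add (integrable_const 1), integral_const_mul, hν.mean_zero]
        · simp
        · exact Integrable.const_mul (Integrable.of_bound measurable_id.aestronglyMeasurable 2
            (by filter_upwards [hb] with x hx using hx)) a

/-- The partial sums. -/
def psum (x : ℕ → ℝ) (n : ℕ) : ℝ := ∑ i ∈ Finset.range n, x i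

lemma CentredLaw.measure_line_crossing_le {ν : Measure ℝ} (hν : CentredLaw ν) {a : ℝ}
    (ha : |a| ≤ 1 / 4) {δ : ℝ} (hδ : 0 < δ) :
    Measure.infinitePi (fun _ : ℕ => ν)
      {x | ∃ n, a ^ 2 * psum (fun i => x i ^ 2) n + Real.log (1 / δ) ≤ a * psum x n}
      ≤ ENNReal.ofReal δ := by
  have := hν.prob
  have hV := mul_measure_exists_le_prod_le (ν := ν)
    (f := fun x => ENNReal.ofReal (Real.exp (a * x - a ^ 2 * x ^ 2)))
    (by fun_prop) (hν.lintegral_exp_le ha) (ENNReal.ofReal (1 / δ))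
  have hset : {x : ℕ → ℝ | ∃ n, a ^ 2 * psum (fun i => x i ^ 2) n + Real.log (1 / δ) ≤ a * psum x n}
      = {x | ∃ n, ENNReal.ofReal (1 / δ) ≤ ∏ i ∈ Finset.range n,
          ENNReal.ofReal (Real.exp (a * x i - a ^ 2 * x i ^ 2))} := by
    ext x
    simp only [mem_ofPred_eq]
    refine exists_congr fun n => ?_
    rw [← ENNReal.ofReal_prod_of_nonneg (fun _ _ => (Real.exp_pos _).le), ← Real.exp_sum,
      ENNReal.ofReal_le_ofReal_iff (Real.exp_pos _).le, ← Real.log_le_iff_le_exp (by positivity),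
      Finset.sum_sub_distrib, ← Finset.mul_sum, ← Finset.mul_sum]
    unfold psum
    constructor <;> intro h <;> linarith
  rw [hset]
  have h0 : ENNReal.ofReal (1 / δ) * ENNReal.ofReal δ = 1 := by
    rw [← ENNReal.ofReal_mul (by positivity), one_div_mul_cancel hδ.ne', ENNReal.ofReal_one]
  rw [← h0] at hV
  exact (ENNReal.mul_le_mul_iff_right (by simpa using hδ) ENNReal.ofReal_ne_top).1 hV

lemma tsum_ofReal_div_mul_succ_le {δ : ℝ} (hδ : 0 ≤ δ) :
    ∑' k : ℕ, ENNReal.ofReal (δ / ((k + 1) * (k + 2))) ≤ ENNReal.ofReal δ := by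
  rw [ENNReal.tsum_eq_iSup_nat]
  refine iSup_le fun n => ?_
  rw [← ENNReal.ofReal_sum_of_nonneg (fun i _ => by positivity)]
  refine ENNReal.ofReal_le_ofReal ?_
  have : ∑ k ∈ Finset.range n, δ / (((k : ℝ) + 1) * (k + 2)) = δ * (1 - 1 / (n + 1)) := by
    induction n with
    | zero => simp
    | succ n ih => rw [Finset.sum_range_succ, ih]; push_cast; field_simp; ring
  rw [this]
  have : (0 : ℝ) ≤ 1 / (n + 1) := by positivity
  nlinarith

/-- The curved boundary that the stitched line-crossing inequality yields. -/
def curve (W l : ℝ) : ℝ := √((W + l + 1) * (lnlnPlus (W + l + 1) + l))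

lemma le_log_max (x : ℝ) : Real.exp 1 ≤ Real.log (max x (Real.exp (Real.exp 1))) := by
  rw [Real.le_log_iff_exp_le (lt_max_of_lt_right (Real.exp_pos _))]
  exact le_max_right _ _

lemma one_le_lnlnPlus (x : ℝ) : 1 ≤ lnlnPlus x := by
  have h := le_log_max x
  rw [lnlnPlus, Real.le_log_iff_exp_le (lt_of_lt_of_le (Real.exp_pos _) h)]
  exact h

lemma lnlnPlus_mono {x y : ℝ} (h : x ≤ y) : lnlnPlus x ≤ lnlnPlus y := by
  have hx := le_log_max x
  refine Real.log_le_log (lt_of_lt_of_le (Real.exp_pos _) hx) (Real.log_le_log ?_ ?_)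
  · exact lt_max_of_lt_right (Real.exp_pos _)
  · exact max_le_max_right _ h

/-- Both the inner and the outer logarithm are at least 1, so the summand log c ≤ c - 1 is absorbed
each time by the factor c. -/
lemma lnlnPlus_mul_le {c x : ℝ} (hc : 1 ≤ c) : lnlnPlus (c * x) ≤ c * lnlnPlus x := by
  have he := Real.exp_pos (Real.exp 1)
  have h1 := le_log_max x
  have he1 : (1 : ℝ) ≤ Real.exp 1 := by have := Real.add_one_le_exp (1 : ℝ); linarith
  set y := Real.log (max x (Real.exp (Real.exp 1))) with hy
  have hlc : Real.log c ≤ c - 1 := Real.log_le_sub_one_of_pos (by linarith)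
  have hlc0 : 0 ≤ Real.log c := Real.log_nonneg hc
  have h2 : Real.log (max (c * x) (Real.exp (Real.exp 1))) ≤ c * y := by
    calc _ ≤ Real.log (c * max x (Real.exp (Real.exp 1))) := by
          refine Real.log_le_log (lt_max_of_lt_right he) (max_le ?_ ?_)
          · exact mul_le_mul_of_nonneg_left (le_max_left _ _) (by linarith)
          · have := le_max_right x (Real.exp (Real.exp 1)); nlinarith
      _ = Real.log c + y := by
          rw [Real.log_mul (by linarith) (lt_max_of_lt_right he).ne']
      _ ≤ c * y := by nlinarith
  have hL : 1 ≤ Real.log y := one_le_lnlnPlus x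
  calc lnlnPlus (c * x) ≤ Real.log (c * y) :=
        Real.log_le_log (lt_of_lt_of_le (Real.exp_pos _) (le_log_max _)) h2
    _ = Real.log c + Real.log y := Real.log_mul (by linarith) (by linarith)
    _ ≤ c * Real.log y := by nlinarith

lemma lnlnPlus_le_self {x : ℝ} (hx : 1 ≤ x) : lnlnPlus x ≤ x := by
  rcases le_or_gt x (Real.exp (Real.exp 1)) with h | h
  · rw [lnlnPlus, max_eq_right h]; simpa using hx
  · have h0 := le_log_max x
    rw [lnlnPlus]
    have h1 := Real.log_le_sub_one_of_pos (lt_of_lt_of_le (Real.exp_pos _) h0)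
    rw [max_eq_left h.le] at *
    have h2 := Real.log_le_sub_one_of_pos (show 0 < x by linarith)
    linarith

/-- The price of the scale k in the union bound. When 4^k ≤ 2x, k is at most of order log x, so the
logarithm of the weight is of order ln ln x. -/
lemma log_stitch_le {k : ℕ} {x : ℝ} (h : (4 : ℝ) ^ k ≤ 2 * x) :
    Real.log (2 * ((k + 1) * (k + 2))) ≤ 5 * lnlnPlus x := by
  have hx : 0 < x := by have : (0 : ℝ) < 4 ^ k := by positivity
                        linarith
  have h1 := le_log_max x
  have hL : 1 ≤ lnlnPlus x := one_le_lnlnPlus x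
  rw [lnlnPlus] at *
  set y := Real.log (max x (Real.exp (Real.exp 1))) with hy
  have he := Real.exp_one_gt_d9
  have h2 : k * Real.log 4 ≤ Real.log 2 + y := by
    rw [← Real.log_pow]
    calc _ ≤ Real.log (2 * x) := Real.log_le_log (by positivity) h
      _ = Real.log 2 + Real.log x := Real.log_mul (by norm_num) hx.ne'
      _ ≤ _ := by have := Real.log_le_log hx (le_max_left x (Real.exp (Real.exp 1))); linarith
  have h4 : Real.log 4 = 2 * Real.log 2 := by
    rw [show (4 : ℝ) = 2 ^ 2 by norm_num, Real.log_pow]; norm_num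
  have hl1 := Real.log_two_gt_d9
  have hl2 := Real.log_two_lt_d9
  have hk : (k : ℝ) + 2 ≤ 2 * y := by
    rw [h4] at h2
    have hk0 : (0 : ℝ) ≤ k := Nat.cast_nonneg k
    nlinarith
  calc _ ≤ Real.log (8 * y ^ 2) := by
        refine Real.log_le_log (by positivity) ?_
        have hk0 : (0 : ℝ) ≤ k := Nat.cast_nonneg k
        nlinarith
    _ = 3 * Real.log 2 + 2 * Real.log y := by
        have hy0 : y ≠ 0 := by linarith
        rw [Real.log_mul (by norm_num) (by positivity), Real.log_pow,
          show (8 : ℝ) = 2 ^ 3 by norm_num, Real.log_pow]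
        norm_num
    _ ≤ _ := by linarith

/-- Stitching: S ≤ aW + (cost)/a is available only for dyadic a, but the best slope lies within a
constant factor of one of these, and its index is small enough for its cost to be O(ln ln). -/
lemma le_curve_of_lines {S W l : ℝ} (hW : 0 ≤ W) (hl : 0 ≤ l)
    (h : ∀ k : ℕ, (1 / 2 : ℝ) ^ k / 4 * S
      ≤ ((1 / 2 : ℝ) ^ k / 4) ^ 2 * W + (Real.log (2 * ((k + 1) * (k + 2))) + l)) :
    S ≤ 30 * curve W l := by
  set x := W + l + 1 with hx
  set L := lnlnPlus x + l with hL
  have hx1 : 1 ≤ x := by linarith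
  have hlx := lnlnPlus_le_self hx1
  have hl1 := one_le_lnlnPlus x
  have hL1 : 1 ≤ L := by linarith
  have hL2 : L ≤ 2 * x := by linarith
  -- The balancing slope is of order √(L/x). The factor 2 makes it at most 1, because L ≤ 2x, so a
  -- dyadic neighbour 2⁻ᵏ with k ≥ 0 exists.
  have hr0 : 0 < √(L / (2 * x)) := Real.sqrt_pos.2 (by positivity)
  have hrsq : √(L / (2 * x)) ^ 2 = L / (2 * x) := Real.sq_sqrt (by positivity)
  have hr1 : √(L / (2 * x)) ≤ 1 := by
    exact Real.sqrt_le_iff.2 ⟨zero_le_one, by rw [one_pow, div_le_one (by positivity)]; exact hL2⟩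
  set r := √(L / (2 * x)) with hr
  obtain ⟨k, hk1, hk2⟩ := exists_nat_pow_near_of_lt_one hr0 hr1 (by norm_num : (0 : ℝ) < 1 / 2)
    (by norm_num)
  have hp : (0 : ℝ) < (1 / 2) ^ k := by positivity
  have h4k : (4 : ℝ) ^ k ≤ 2 * x := by
    have h1 : r ^ 2 ≤ ((1 / 2 : ℝ) ^ k) ^ 2 := pow_le_pow_left₀ hr0.le hk2 2
    have h2 : ((1 / 2 : ℝ) ^ k) ^ 2 * 4 ^ k = 1 := by
      rw [← pow_mul, mul_comm k 2, pow_mul, ← mul_pow]; norm_num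
    have h3 : L / (2 * x) * 4 ^ k ≤ 1 := by
      rw [← h2, ← hrsq]; gcongr
    rw [div_mul_eq_mul_div, div_le_one (by positivity)] at h3
    nlinarith [show (0 : ℝ) < 4 ^ k by positivity]
  have hlog := log_stitch_le h4k
  have hk := h k
  set a := (1 / 2 : ℝ) ^ k / 4 with ha
  have ha0 : 0 < a := by positivity
  have har : a ≤ r / 2 := by
    rw [pow_succ] at hk1; rw [ha]; linarith
  have har' : r / 4 ≤ a := by rw [ha]; linarith
  have hS : S ≤ a * x + 5 * L / a := by
    have : a * S ≤ a * (a * x + 5 * L / a) := by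
      have e : a * (a * x + 5 * L / a) = a ^ 2 * x + 5 * L := by field_simp
      rw [e]
      have : a ^ 2 * W ≤ a ^ 2 * x := by gcongr; linarith
      linarith
    exact le_of_mul_le_mul_left this ha0
  have hcurve : curve W l = r * x * √2 := by
    rw [curve, Real.sqrt_eq_iff_mul_self_eq (by positivity) (by positivity)]
    have : (√2 : ℝ) * √2 = 2 := Real.mul_self_sqrt (by norm_num)
    calc (W + l + 1) * (lnlnPlus (W + l + 1) + l) = x * L := rfl
      _ = r ^ 2 * x ^ 2 * (√2 * √2) := by rw [hrsq, this]; field_simp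
      _ = r * x * √2 * (r * x * √2) := by ring
  rw [hcurve]
  have hrL : L = 2 * r ^ 2 * x := by rw [hrsq]; field_simp
  have h5 : 5 * L / a ≤ 40 * r * x := by
    rw [div_le_iff₀ ha0, hrL]
    nlinarith [mul_le_mul_of_nonneg_left har' (show 0 ≤ 40 * r * x by positivity)]
  -- In total S ≤ (1/2 + 40) r x, while 30 times the curve is 30 √2 r x ≥ 42 r x.
  have hs2 : (1.4 : ℝ) ≤ √2 := Real.le_sqrt_of_sq_le (by norm_num)
  have hrx : 0 ≤ r * x := by positivity
  nlinarith [mul_le_mul_of_nonneg_right har (show 0 ≤ x by linarith),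
    mul_le_mul_of_nonneg_left hs2 hrx]

lemma abs_psum_le {x : ℕ → ℝ} (h : ∀ i, |x i| ≤ 2) (n : ℕ) : |psum x n| ≤ 2 * n := by
  refine (Finset.abs_sum_le_sum_abs _ _).trans ?_
  refine (Finset.sum_le_card_nsmul _ _ 2 fun i _ => h i).trans ?_
  simp [mul_comm]

lemma psum_sq_nonneg (x : ℕ → ℝ) (n : ℕ) : 0 ≤ psum (fun i => x i ^ 2) n :=
  Finset.sum_nonneg fun _ _ => sq_nonneg _

lemma psum_sq_le {x : ℕ → ℝ} (h : ∀ i, |x i| ≤ 2) (n : ℕ) : psum (fun i => x i ^ 2) n ≤ 4 * n := by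
  refine (Finset.sum_le_card_nsmul _ _ 4 fun i _ => ?_).trans ?_
  · have := abs_le.1 (h i); nlinarith
  · simp [mul_comm]

/-- Subadditivity on s ∪ t replaces the complement formula, so that neither event has to be
measurable. -/
lemma ofReal_one_sub_le_measure {α : Type*} [MeasurableSpace α] {μ : Measure α}
    [IsProbabilityMeasure μ] {s t : Set α} {δ : ℝ} (hδ : 0 ≤ δ) (h : sᶜ ⊆ t)
    (ht : μ t ≤ ENNReal.ofReal δ) : ENNReal.ofReal (1 - δ) ≤ μ s := by
  rw [ENNReal.ofReal_sub _ hδ, ENNReal.ofReal_one, tsub_le_iff_right]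
  calc (1 : ℝ≥0∞) = μ univ := measure_univ.symm
    _ ≤ μ (s ∪ t) := measure_mono fun x _ => by
        by_cases hx : x ∈ s
        · exact Or.inl hx
        · exact Or.inr (h hx)
    _ ≤ μ s + μ t := measure_union_le _ _
    _ ≤ _ := by gcongr

/-- The uniform self-normalised deviation inequality for centred i.i.d. variables in `[-2,2]`. -/
lemma CentredLaw.self_normalised {ν : Measure ℝ} (hν : CentredLaw ν) {δ : ℝ} (hδ : 0 < δ)
    (hδ1 : δ < 1) :
    ENNReal.ofReal (1 - δ) ≤ Measure.infinitePi (fun _ : ℕ => ν)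
      {x | (∀ i, |x i| ≤ 2) ∧ ∀ n,
        |psum x n| ≤ 30 * curve (psum (fun i => x i ^ 2) n) (Real.log (1 / δ))} := by
  have := hν.prob
  set P := Measure.infinitePi (fun _ : ℕ => ν)
  have hl : 0 ≤ Real.log (1 / δ) := Real.log_nonneg (by rw [le_div_iff₀ hδ]; linarith)
  -- The level of scale k is halved because both signs of the slope are used.
  let d : ℕ → ℝ := fun k => δ / ((k + 1) * (k + 2)) / 2
  have hd : ∀ k, 0 < d k := fun k => by positivity
  let line : ℝ → ℕ → Set (ℕ → ℝ) := fun a k =>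
    {x | ∃ n, a ^ 2 * psum (fun i => x i ^ 2) n + Real.log (1 / d k) ≤ a * psum x n}
  have hlog : ∀ k, Real.log (1 / d k) = Real.log (2 * ((k + 1) * (k + 2))) + Real.log (1 / δ) := by
    intro k
    rw [← Real.log_mul (by positivity) (by positivity)]
    congr 1
    simp only [d]; field_simp
  have ha : ∀ k : ℕ, |(1 / 2 : ℝ) ^ k / 4| ≤ 1 / 4 := fun k => by
    rw [abs_of_nonneg (by positivity)]
    gcongr
    exact pow_le_one₀ (by norm_num) (by norm_num)
  refine ofReal_one_sub_le_measure hδ.le (t := {x | ¬ ∀ i, |x i| ≤ 2} ∪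
    ⋃ k : ℕ, (line ((1 / 2) ^ k / 4) k ∪ line (-((1 / 2) ^ k / 4)) k)) ?_ ?_
  · intro x hx
    by_contra hcon
    simp only [mem_union, mem_iUnion, not_or, not_exists, mem_ofPred_eq, not_not, line, not_le] at hcon
    refine hx ⟨hcon.1, fun n => ?_⟩
    rw [abs_le]
    have hW := psum_sq_nonneg x n
    constructor
    · rw [neg_le]
      refine le_curve_of_lines hW hl fun k => ?_
      have := (hcon.2 k).2 n
      rw [hlog, neg_sq] at this
      linarith
    · refine le_curve_of_lines hW hl fun k => ?_
      have := (hcon.2 k).1 n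
      rw [hlog] at this
      linarith
  · have h0 : P {x | ¬ ∀ i, |x i| ≤ 2} = 0 := by
      rw [← ae_iff, ae_all_iff]
      intro i
      exact (measurePreserving_eval_infinitePi (fun _ : ℕ => ν) i).quasiMeasurePreserving.ae
        hν.ae_abs_le
    refine (measure_union_le _ _).trans ?_
    rw [h0, zero_add]
    refine ((measure_iUnion_le _).trans (ENNReal.tsum_le_tsum fun k => ?_)).trans
      (tsum_ofReal_div_mul_succ_le hδ.le)
    refine (measure_union_le _ _).trans ?_
    refine (add_le_add (hν.measure_line_crossing_le (ha k) (hd k))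
      (hν.measure_line_crossing_le (by rw [abs_neg]; exact ha k) (hd k))).trans ?_
    rw [← ENNReal.ofReal_add (hd k).le (hd k).le]
    simp only [d, add_halves]
    exact le_rfl

/-! ## Admissible constants exist -/

lemma sum_firstTerms (x : ℕ → ℝ) (n : ℕ) : (firstTerms x n).sum = psum x n := by
  rw [firstTerms, psum, Finset.sum_range]
  induction n with
  | zero => simp
  | succ n ih => rw [List.range_succ, List.map_append, List.sum_append, ih, Fin.sum_univ_castSucc]; simp

lemma length_firstTerms (x : ℕ → ℝ) (n : ℕ) : (firstTerms x n).length = n := by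
  simp [firstTerms]

lemma empVar_firstTerms (x : ℕ → ℝ) (n : ℕ) : empVar (firstTerms x n)
    = (n : ℝ) / ((n : ℝ) - 1) * (psum (fun i => x i ^ 2) n - 1 / (n : ℝ) * psum x n ^ 2) := by
  have : (firstTerms x n).map (fun a => a ^ 2) = firstTerms (fun i => x i ^ 2) n := by
    simp [firstTerms]
  rw [empVar, length_firstTerms, this, sum_firstTerms, sum_firstTerms]

lemma psum_sq_le_mul (x : ℕ → ℝ) (n : ℕ) :
    psum x n ^ 2 ≤ n * psum (fun i => x i ^ 2) n := by
  simpa [psum] using sq_sum_le_card_mul_sum_sq (s := Finset.range n) (f := x)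

lemma sub_le_empVar_firstTerms (x : ℕ → ℝ) {n : ℕ} (hn : 2 ≤ n) :
    psum (fun i => x i ^ 2) n - psum x n ^ 2 / n ≤ empVar (firstTerms x n) := by
  have hn' : (2 : ℝ) ≤ n := by exact_mod_cast hn
  rw [empVar_firstTerms, one_div_mul_eq_div]
  have h0 : 0 ≤ psum (fun i => x i ^ 2) n - psum x n ^ 2 / n := by
    rw [sub_nonneg, div_le_iff₀ (by linarith), mul_comm]
    exact psum_sq_le_mul x n
  refine le_mul_of_one_le_left h0 ?_
  rw [le_div_iff₀ (by linarith)]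
  linarith

lemma empVar_firstTerms_nonneg (x : ℕ → ℝ) (n : ℕ) : 0 ≤ empVar (firstTerms x n) := by
  rcases lt_or_ge n 2 with h | h
  · interval_cases n <;> simp [empVar_firstTerms]
  · refine le_trans ?_ (sub_le_empVar_firstTerms x h)
    have hn' : (0 : ℝ) < n := by exact_mod_cast (by omega : 0 < n)
    rw [sub_nonneg, div_le_iff₀ hn', mul_comm]
    exact psum_sq_le_mul x n

lemma curve_le {W X l c : ℝ} (hc : 1 ≤ c) (hl : 0 ≤ l) (hX : 0 ≤ X)
    (h : W + l + 1 ≤ c * X) : curve W l ≤ c * √(X * (lnlnPlus X + l)) := by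
  have h1 := (lnlnPlus_mono h).trans (lnlnPlus_mul_le hc)
  have h2 := one_le_lnlnPlus (W + l + 1)
  rw [curve, Real.sqrt_le_iff]
  refine ⟨by positivity, ?_⟩
  have h3 := one_le_lnlnPlus X
  rw [mul_pow, Real.sq_sqrt (by positivity)]
  calc _ ≤ (c * X) * (c * (lnlnPlus X + l)) := by
        gcongr
        nlinarith
    _ = _ := by ring

lemma exists_uniformBernstein : ∃ D₀ : ℝ, UniformBernstein D₀ := by
  -- For l ≤ 4n, W + l + 1 ≤ 3 · 4n and the constant is 30 · 3. For l > 4n the trivial bound 2n is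
  -- already below l.
  refine ⟨90, fun ν hν δ hδ hδ1 => (hν.self_normalised hδ hδ1).trans (measure_mono ?_)⟩
  rintro x ⟨hb, hx⟩ n hn
  have hl : 0 ≤ Real.log (1 / δ) := Real.log_nonneg (by rw [le_div_iff₀ hδ]; linarith)
  rw [sum_firstTerms, pThreshold]
  set l := Real.log (1 / δ)
  have hn' : (1 : ℝ) ≤ n := by exact_mod_cast hn
  have hs := Real.sqrt_nonneg (4 * n * (lnlnPlus (4 * n) + l))
  rcases le_or_gt l (4 * n) with h | h
  · have hW := psum_sq_le hb n
    have := curve_le (W := psum (fun i => x i ^ 2) n) (X := 4 * n) (c := 3) (l := l) (by norm_num) hl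
      (by positivity) (by linarith)
    linarith [hx n]
  · have := abs_psum_le hb n
    linarith

lemma exists_uniformEmpiricalBernstein : ∃ D₁ : ℝ, UniformEmpiricalBernstein D₁ := by
  refine ⟨1000000000, fun ν hν δ hδ hδ1 => (hν.self_normalised hδ hδ1).trans (measure_mono ?_)⟩
  rintro x ⟨hb, hx⟩ n hn hln
  have hl : 0 ≤ Real.log (1 / δ) := Real.log_nonneg (by rw [le_div_iff₀ hδ]; linarith)
  rw [sum_firstTerms, qThreshold]
  set l := Real.log (1 / δ)
  have hn' : (1 : ℝ) ≤ n := by exact_mod_cast hn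
  have htriv := abs_psum_le hb n
  have hV := empVar_firstTerms_nonneg x n
  have hs := Real.sqrt_nonneg ((empVar (firstTerms x n) + l + 1) *
    (lnlnPlus (empVar (firstTerms x n) + l + 1) + l))
  have hsub := sub_le_empVar_firstTerms x (n := n)
  set V := empVar (firstTerms x n)
  set W := psum (fun i => x i ^ 2) n
  have hW := psum_sq_le hb n
  have hW0 := psum_sq_nonneg x n
  -- For n = 1 the factor n/(n-1) is 1/0 = 0, so V vanishes and only |X₁| ≤ 2 is available.
  rcases Nat.lt_or_ge n 2 with h2 | h2
  · obtain rfl : n = 1 := by omega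
    norm_num at htriv
    linarith
  by_cases hcase : W + l + 1 ≤ 2 * (V + l + 1)
  · have := curve_le (W := W) (X := V + l + 1) (c := 2) (l := l) (by norm_num) hl
      (by positivity) hcase
    linarith [hx n]
  -- Here W exceeds 2V + l + 1, so by V ≥ W - S²/n most of W comes from the mean. Combined with S² =
  -- O(W L), L = ln ln + l, this forces n = O(L). As ln ln grows slowly, n is then O(1 + l), and the
  -- trivial bound |S| ≤ 2n suffices.
  have h3 : W * n < 2 * psum x n ^ 2 := by
    have h := hsub h2
    have : W < 2 * (psum x n ^ 2 / n) := by linarith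
    rw [← mul_div_assoc, lt_div_iff₀ (by linarith)] at this
    exact this
  have h4 : l + 1 ≤ W := by linarith
  have hL := one_le_lnlnPlus (W + l + 1)
  have h5 : psum x n ^ 2 ≤ 900 * ((W + l + 1) * (lnlnPlus (W + l + 1) + l)) := by
    have h := pow_le_pow_left₀ (abs_nonneg _) (hx n) 2
    rw [sq_abs, mul_pow, curve, Real.sq_sqrt (by positivity)] at h
    linarith
  have h6 : (n : ℝ) < 3600 * (lnlnPlus (W + l + 1) + l) := by
    have : W * n < W * (3600 * (lnlnPlus (W + l + 1) + l)) := by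
      have : (W + l + 1) * (lnlnPlus (W + l + 1) + l) ≤ 2 * W * (lnlnPlus (W + l + 1) + l) := by
        gcongr; linarith
      linarith
    exact lt_of_mul_lt_mul_left this hW0
  -- The slope 1/7200 makes 3600 times it equal to n/2, which is absorbed on the left. The bound W +
  -- l + 1 ≤ 6n uses l ≤ n.
  have h7 : lnlnPlus (W + l + 1) ≤ n / 7200 + 50000 := by
    refine (lnlnPlus_mono (show W + l + 1 ≤ 6 * n by linarith)).trans ?_
    have h0 := le_log_max (6 * n)
    have hy : Real.log (max (6 * n) (Real.exp (Real.exp 1))) ≤ Real.log (6 * n) + Real.exp 1 := by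
      have h6n : 0 ≤ Real.log (6 * n) := Real.log_nonneg (by linarith)
      rcases max_choice (6 * (n : ℝ)) (Real.exp (Real.exp 1)) with h | h <;> rw [h]
      · linarith [Real.exp_pos 1]
      · rw [Real.log_exp]; linarith
    have h8 := Real.log_le_sub_one_of_pos (lt_of_lt_of_le (Real.exp_pos _) h0)
    have h9 := Real.log_le_sub_one_of_pos (show (0 : ℝ) < 6 * n / 43200 by positivity)
    rw [Real.log_div (by positivity) (by norm_num)] at h9
    have h10 := Real.log_le_sub_one_of_pos (show (0 : ℝ) < 43200 by norm_num)
    have h11 := Real.exp_one_lt_d9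
    rw [lnlnPlus]
    linarith
  linarith

/-! ## Error probabilities of the tests -/

/-- A two-sided bound for centred laws gives a one-sided test for laws of nonpositive mean; the
boundary case of equality costs nothing because the threshold is strictly monotone in the level. -/
lemma one_sided_of_two_sided {Θ : ℝ → List ℝ → ℝ} {c : ℝ → ℕ → Prop}
    (hΘ : ∀ ν : Measure ℝ, CentredLaw ν → ∀ δ : ℝ, 0 < δ → δ < 1 →
      ENNReal.ofReal (1 - δ) ≤ Measure.infinitePi (fun _ : ℕ => ν)
        {x | ∀ n : ℕ, 0 < n → c δ n → |(firstTerms x n).sum| ≤ Θ δ (firstTerms x n)})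
    (hshift : ∀ δ x n m, 0 < n →
      Θ δ (firstTerms (fun i => x i - m) n) = Θ δ (firstTerms x n))
    (hanti : ∀ δ δ' x n, 0 < δ → δ < δ' → δ' < 1 → Θ δ' (firstTerms x n) < Θ δ (firstTerms x n))
    (hc : ∀ δ δ' n, 0 < δ → δ < δ' → c δ n → c δ' n)
    (hmeas : ∀ δ n, Measurable fun x => Θ δ (firstTerms x n))
    {ν : Measure ℝ} [IsProbabilityMeasure ν] (hb : ∀ᵐ x ∂ν, |x| ≤ 1) (hmean : ∫ x, x ∂ν ≤ 0)
    {δ : ℝ} (hδ : 0 < δ) (hδ1 : δ < 1) :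
    Measure.infinitePi (fun _ : ℕ => ν)
      {x | ∃ n, 0 < n ∧ c δ n ∧ Θ δ (firstTerms x n) ≤ (firstTerms x n).sum}
      ≤ ENNReal.ofReal δ := by
  set m := ∫ x, x ∂ν with hm
  have hint : Integrable (fun x : ℝ => x) ν :=
    Integrable.of_bound measurable_id.aestronglyMeasurable 1 hb
  have hm1 : |m| ≤ 1 := by
    have := norm_integral_le_of_norm_le_const (f := fun x : ℝ => x) (C := 1) hb
    simpa using this
  have hsm : Measurable fun x : ℝ => x - m := by fun_prop
  have hcentre : CentredLaw (ν.map fun x => x - m) := by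
    refine ⟨Measure.isProbabilityMeasure_map hsm.aemeasurable, ?_, ?_⟩
    · rw [Measure.map_apply hsm measurableSet_Icc.compl]
      refine measure_mono_null ?_ (mem_ae_iff.1 hb)
      intro x hx hx'
      refine hx ?_
      -- Centring shifts by at most 1, which is why the concentration bounds are needed on [-2,2]
      -- although the tested variables lie in [-1,1].
      have h1 := abs_le.1 (show |x| ≤ 1 from hx')
      have h2 := abs_le.1 hm1
      constructor <;> linarith [h1.1, h1.2, h2.1, h2.2]
    · rw [integral_map hsm.aemeasurable (by fun_prop), integral_sub hint (integrable_const m)]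
      simp [← hm]
  have := hcentre.prob
  have hmap := Measure.infinitePi_map_pi (fun _ : ℕ => ν) (f := fun _ : ℕ => fun x => x - m)
    (fun _ => hsm)
  have key : ∀ δ' : ℝ, δ < δ' → δ' < 1 → Measure.infinitePi (fun _ : ℕ => ν)
      {x | ∃ n, 0 < n ∧ c δ n ∧ Θ δ (firstTerms x n) ≤ (firstTerms x n).sum}
      ≤ ENNReal.ofReal δ' := by
    intro δ' h h1
    set G : Set (ℕ → ℝ) :=
      {x | ∀ n : ℕ, 0 < n → c δ' n → |(firstTerms x n).sum| ≤ Θ δ' (firstTerms x n)} with hG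
    have hGm : MeasurableSet G := by
      simp only [hG, ofPred_forall, sum_firstTerms, psum]
      refine .iInter fun n => .iInter fun _ => .iInter fun _ => measurableSet_le ?_ (hmeas δ' n)
      fun_prop
    have hcompl : Measure.infinitePi (fun _ : ℕ => ν.map fun x => x - m) Gᶜ ≤ ENNReal.ofReal δ' := by
      rw [prob_compl_eq_one_sub hGm, tsub_le_iff_right]
      refine le_trans ?_ (add_le_add_right (hΘ _ hcentre δ' (hδ.trans h) h1) _)
      rw [← ENNReal.ofReal_add (hδ.trans h).le (by linarith)]
      simp
    refine le_trans (measure_mono ?_) ((Measure.le_map_apply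
      (f := fun (x : ℕ → ℝ) i => x i - m)
      (Measurable.aemeasurable (by fun_prop)) Gᶜ).trans (hmap ▸ hcompl))
    rintro x ⟨n, hn, hcn, hx⟩ hxG
    have h3 := (le_abs_self _).trans (hxG n hn (hc _ _ n hδ h hcn))
    rw [hshift _ _ _ _ hn] at h3
    have h4 : (firstTerms x n).sum ≤ (firstTerms (fun i => x i - m) n).sum := by
      rw [sum_firstTerms, sum_firstTerms]
      refine Finset.sum_le_sum fun i _ => by linarith
    linarith [hanti δ δ' x n hδ h h1]
  have hlim : Filter.Tendsto ENNReal.ofReal (nhdsWithin δ (Ioi δ)) (nhds (ENNReal.ofReal δ)) :=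
    ENNReal.continuous_ofReal.continuousAt.tendsto.mono_left nhdsWithin_le_nhds
  refine ge_of_tendsto hlim ?_
  filter_upwards [Ioo_mem_nhdsGT hδ1] with δ' h using key δ' h.1 h.2

/-! ### Positivity of admissible constants -/

/-- The law of a random sign. -/
def signLaw : Measure ℝ := (2 : ℝ≥0∞)⁻¹ • (Measure.dirac 1 + Measure.dirac (-1))

lemma centredLaw_signLaw : CentredLaw signLaw := by
  refine ⟨⟨?_⟩, ?_, ?_⟩
  · simp [signLaw, ENNReal.inv_two_add_inv_two]
  · simp only [signLaw, Measure.smul_apply, Measure.add_apply, smul_eq_mul, mul_eq_zero]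
    right
    rw [Measure.dirac_apply' _ measurableSet_Icc.compl,
      Measure.dirac_apply' _ measurableSet_Icc.compl]
    norm_num
  · rw [signLaw, integral_smul_measure, integral_add_measure]
    · simp
    all_goals exact integrable_dirac (by simp)

lemma ae_abs_signLaw : ∀ᵐ x ∂signLaw, |x| = 1 := by
  rw [ae_iff]
  have hm : MeasurableSet {x : ℝ | ¬ |x| = 1} :=
    (measurableSet_eq_fun (by fun_prop) measurable_const).compl
  simp only [signLaw, Measure.smul_apply, Measure.add_apply, smul_eq_mul, mul_eq_zero]
  right
  rw [Measure.dirac_apply' _ hm, Measure.dirac_apply' _ hm]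
  simp

lemma exists_first_sign {S : Set (ℕ → ℝ)}
    (h : ENNReal.ofReal (1 - 1 / 2) ≤ Measure.infinitePi (fun _ : ℕ => signLaw) S) :
    ∃ x ∈ S, |x 0| = 1 := by
  have := centredLaw_signLaw.prob
  by_contra! hcon
  have h0 : ∀ᵐ x ∂Measure.infinitePi (fun _ : ℕ => signLaw), |x 0| = 1 :=
    (measurePreserving_eval_infinitePi (fun _ : ℕ => signLaw) 0).quasiMeasurePreserving.ae
      ae_abs_signLaw
  have : Measure.infinitePi (fun _ : ℕ => signLaw) S = 0 :=
    measure_mono_null (fun x hx => hcon x hx) h0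
  rw [this] at h
  norm_num at h

/-- For random signs |X₁| = 1, so the threshold at n = 1 cannot be nonpositive. Positivity is what
makes the threshold strictly monotone in the level. -/
lemma UniformBernstein.pos {D₀ : ℝ} (h : UniformBernstein D₀) : 0 < D₀ := by
  obtain ⟨x, hx, h1⟩ := exists_first_sign (h _ centredLaw_signLaw (1 / 2) (by norm_num) (by norm_num))
  have := hx 1 one_pos
  rw [sum_firstTerms, psum, Finset.sum_range_one, h1, pThreshold] at this
  have hl : 0 ≤ Real.log (1 / (1 / 2)) := Real.log_nonneg (by norm_num)
  exact pos_of_mul_pos_left (lt_of_lt_of_le one_pos this) (by positivity)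

lemma UniformEmpiricalBernstein.pos {D₁ : ℝ} (h : UniformEmpiricalBernstein D₁) : 0 < D₁ := by
  obtain ⟨x, hx, h1⟩ := exists_first_sign (h _ centredLaw_signLaw (1 / 2) (by norm_num) (by norm_num))
  -- The level 1/2 is chosen because ln 2 ≤ 1 makes n = 1 an admitted time.
  have hl1 : Real.log (1 / (1 / 2)) ≤ (1 : ℕ) := by
    have := Real.log_two_lt_d9
    norm_num; linarith
  have := hx 1 one_pos hl1
  rw [sum_firstTerms, psum, Finset.sum_range_one, h1, qThreshold] at this
  have hl : 0 ≤ Real.log (1 / (1 / 2)) := Real.log_nonneg (by norm_num)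
  exact pos_of_mul_pos_left (lt_of_lt_of_le one_pos this) (by positivity)

lemma log_one_div_lt {δ δ' : ℝ} (hδ : 0 < δ) (h : δ < δ') :
    Real.log (1 / δ') < Real.log (1 / δ) := by
  have := hδ.trans h
  exact Real.log_lt_log (by positivity) (one_div_lt_one_div_of_lt hδ h)

@[fun_prop]
lemma measurable_lnlnPlus : Measurable lnlnPlus := by
  unfold lnlnPlus
  fun_prop

lemma UniformBernstein.measure_checkSignificant_le {D₀ : ℝ} (h : UniformBernstein D₀)
    {ν : Measure ℝ} [IsProbabilityMeasure ν] (hb : ∀ᵐ x ∂ν, |x| ≤ 1) (hmean : ∫ x, x ∂ν ≤ 0)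
    {δ : ℝ} (hδ : 0 < δ) (hδ1 : δ < 1) :
    Measure.infinitePi (fun _ : ℕ => ν) {x | ∃ n, CheckSignificant D₀ (firstTerms x n) δ}
      ≤ ENNReal.ofReal δ := by
  have hD := h.pos
  refine le_trans (measure_mono ?_) (one_sided_of_two_sided
    (Θ := fun δ X => pThreshold D₀ X.length δ) (c := fun _ _ => True)
    ?_ ?_ ?_ ?_ ?_ hb hmean hδ hδ1)
  · rintro x ⟨n, hn⟩
    refine ⟨n, Nat.pos_of_ne_zero ?_, trivial, hn⟩
    rintro rfl
    have hl : 0 ≤ Real.log (1 / δ) := Real.log_nonneg (by rw [le_div_iff₀ hδ]; linarith)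
    have : pThreshold D₀ 0 δ ≤ 0 := by simpa [CheckSignificant, firstTerms] using hn
    rw [pThreshold] at this
    have : 0 < D₀ * (1 + Real.log (1 / δ) +
      √(4 * (0 : ℕ) * (lnlnPlus (4 * (0 : ℕ)) + Real.log (1 / δ)))) := by positivity
    linarith
  · intro ν hν δ hδ hδ1
    simpa [length_firstTerms] using h ν hν δ hδ hδ1
  · intro δ x n m _
    simp [length_firstTerms]
  · intro δ δ' x n h0 h1 h2
    have h3 := log_one_div_lt h0 h1
    simp only [length_firstTerms, pThreshold]
    refine mul_lt_mul_of_pos_left (add_lt_add_of_lt_of_le (by linarith) (Real.sqrt_le_sqrt ?_)) hD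
    gcongr
  · exact fun _ _ _ _ _ h => h
  · intro δ n
    simp only [length_firstTerms]
    fun_prop

lemma empVar_firstTerms_sub (x : ℕ → ℝ) {n : ℕ} (hn : 0 < n) (m : ℝ) :
    empVar (firstTerms (fun i => x i - m) n) = empVar (firstTerms x n) := by
  have hn' : (n : ℝ) ≠ 0 := by exact_mod_cast hn.ne'
  have h1 : psum (fun i => x i - m) n = psum x n - n * m := by
    simp [psum, Finset.sum_sub_distrib]
  have h2 : psum (fun i => (x i - m) ^ 2) n
      = psum (fun i => x i ^ 2) n - 2 * m * psum x n + n * m ^ 2 := by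
    simp only [psum, sub_sq, Finset.sum_add_distrib, Finset.sum_sub_distrib, Finset.mul_sum]
    simp [mul_comm, mul_left_comm]
  rw [empVar_firstTerms, empVar_firstTerms, h1, h2]
  congr 1
  field_simp
  ring

lemma UniformEmpiricalBernstein.measure_checkSignificantVar_le {D₁ : ℝ}
    (h : UniformEmpiricalBernstein D₁)
    {ν : Measure ℝ} [IsProbabilityMeasure ν] (hb : ∀ᵐ x ∂ν, |x| ≤ 1) (hmean : ∫ x, x ∂ν ≤ 0)
    {δ : ℝ} (hδ : 0 < δ) (hδ1 : δ < 1) :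
    Measure.infinitePi (fun _ : ℕ => ν)
      {x | ∃ n, 0 < n ∧ CheckSignificantVar D₁ (firstTerms x n) δ} ≤ ENNReal.ofReal δ := by
  have hD := h.pos
  refine le_trans (measure_mono ?_) (one_sided_of_two_sided
    (Θ := fun δ X => qThreshold D₁ (empVar X) δ) (c := fun δ n => Real.log (1 / δ) ≤ n)
    h ?_ ?_ ?_ ?_ hb hmean hδ hδ1)
  · rintro x ⟨n, hn, h1, h2⟩
    rw [length_firstTerms] at h1
    exact ⟨n, hn, h1, h2⟩
  · intro δ x n m hn
    simp only [empVar_firstTerms_sub x hn m]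
  · intro δ δ' x n h0 h1 h2
    have h3 := log_one_div_lt h0 h1
    have hV := empVar_firstTerms_nonneg x n
    have hl : 0 ≤ Real.log (1 / δ') :=
      Real.log_nonneg (by rw [le_div_iff₀ (h0.trans h1)]; linarith)
    have h4 := one_le_lnlnPlus (empVar (firstTerms x n) + Real.log (1 / δ') + 1)
    have h5 := lnlnPlus_mono (show empVar (firstTerms x n) + Real.log (1 / δ') + 1
      ≤ empVar (firstTerms x n) + Real.log (1 / δ) + 1 by linarith)
    refine mul_lt_mul_of_pos_left (add_lt_add_of_lt_of_le (by linarith) (Real.sqrt_le_sqrt ?_)) hD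
    gcongr
    linarith
  · intro δ δ' n h0 h1 hc
    exact (log_one_div_lt h0 h1).le.trans hc
  · intro δ n
    simp only [empVar_firstTerms, qThreshold, psum]
    fun_prop

/-! ## Subsequences of labels -/

instance : Finite Response :=
  Finite.of_injective (fun r : Response => (decide (r = .zero), decide (r = .one))) (by
    rintro (_ | _ | _) (_ | _ | _) h <;> simp_all)

instance : DiscreteMeasurableSpace Response := ⟨fun _ => trivial⟩

/-- The set is the preimage of its image under restriction to the finite index set. The σ-algebra is
arbitrary so that the result also applies to those generated by selected rounds. -/
lemma measurableSet_of_dependsOn_finset {ι X : Type*} [MeasurableSpace X] [Countable X]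
    [DiscreteMeasurableSpace X] {m : MeasurableSpace (ι → X)} (s : Finset ι)
    (hm : ∀ i ∈ s, Measurable[m] fun x : ι → X => x i) {S : Set (ι → X)}
    (hS : ∀ x y : ι → X, (∀ i ∈ s, x i = y i) → x ∈ S → y ∈ S) : MeasurableSet[m] S := by
  have hr : Measurable[m] (fun x : ι → X => fun i : s => x i) :=
    measurable_pi_iff.2 fun i => hm i i.2
  have : S = (fun x : ι → X => fun i : s => x i) ⁻¹' ((fun x : ι → X => fun i : s => x i) '' S) := by
    refine (subset_preimage_image _ _).antisymm ?_
    rintro y ⟨x, hx, hxy⟩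
    exact hS x y (fun i hi => congrFun hxy ⟨i, hi⟩) hx
  rw [this]
  exact hr (MeasurableSet.of_discrete)

/-- The law on `Bool` that gives `true` the mass `p`. -/
def boolLaw (p : ℝ≥0∞) : Measure Bool := p • Measure.dirac true + (1 - p) • Measure.dirac false

lemma isProbabilityMeasure_boolLaw {p : ℝ≥0∞} (hp : p ≤ 1) : IsProbabilityMeasure (boolLaw p) :=
  ⟨by simp [boolLaw, add_tsub_cancel_of_le hp]⟩

@[simp] lemma boolLaw_true (p : ℝ≥0∞) : boolLaw p {true} = p := by simp [boolLaw]

@[simp] lemma boolLaw_false (p : ℝ≥0∞) : boolLaw p {false} = 1 - p := by simp [boolLaw]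

/-- The value `±1` of a Boolean. -/
def boolSign (z : Bool) : ℝ := if z then 1 else -1

/-- The response that is an abstention if `a` is false, and otherwise `b` or `g`. -/
def mkResponse (b g : Response) (a z : Bool) : Response :=
  if a then (if z then b else g) else .abstain

/-- The entry `1` for the label `b`, `-1` for the other label, and no entry for an abstention. -/
def signEntry (b : Response) (r : Response) : Option ℝ :=
  if r = .abstain then none else if r = b then some 1 else some (-1)

lemma signEntry_mkResponse {b g : Response} (hb : b ≠ .abstain) (hg : g ≠ .abstain) (hbg : b ≠ g)
    (a z : Bool) : signEntry b (mkResponse b g a z) = if a then some (boolSign z) else none := by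
  cases a <;> cases z <;> simp [signEntry, mkResponse, boolSign, hb, hg, hbg.symm]

/-- A response is generated by two independent coins: whether to answer, and which label to give. If
the labeler never answers, the second bias is 0/0 = 0 and plays no role. -/
lemma prod_boolLaw_map_mkResponse {μ : Measure Response} [IsProbabilityMeasure μ] {b g : Response}
    (hb : b ≠ .abstain) (hg : g ≠ .abstain) (hbg : b ≠ g) :
    ((boolLaw (μ {.abstain}ᶜ)).prod (boolLaw (μ {b} / μ {.abstain}ᶜ))).map
      (fun x => mkResponse b g x.1 x.2) = μ := by
  have hs : μ {.abstain}ᶜ = μ {b} + μ {g} := by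
    rw [← measure_union (by simpa using hbg) (MeasurableSet.of_discrete)]
    congr 1
    ext r
    revert hb hg hbg
    rcases b with _ | _ | _ <;> rcases g with _ | _ | _ <;> rcases r with _ | _ | _ <;> simp
  have ht : μ {b} / μ {.abstain}ᶜ ≤ 1 := by
    refine ENNReal.div_le_of_le_mul ?_
    rw [one_mul, hs]
    exact le_self_add
  have hfin : μ {.abstain}ᶜ ≠ ⊤ := measure_ne_top _ _
  have hmb : μ {.abstain}ᶜ * (μ {b} / μ {.abstain}ᶜ) = μ {b} := by
    refine ENNReal.mul_div_cancel' ?_ fun h => absurd h hfin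
    intro h
    rw [hs] at h
    exact (add_eq_zero.1 h).1
  have := isProbabilityMeasure_boolLaw (prob_le_one (μ := μ) (s := {.abstain}ᶜ))
  have := isProbabilityMeasure_boolLaw ht
  rw [Measure.ext_iff_singleton]
  intro r
  rw [Measure.map_apply (by fun_prop) (MeasurableSet.of_discrete)]
  by_cases h1 : r = .abstain
  · subst h1
    have : (fun x : Bool × Bool => mkResponse b g x.1 x.2) ⁻¹' {.abstain} = {false} ×ˢ univ := by
      ext ⟨a, z⟩; cases a <;> cases z <;> simp [mkResponse, hb, hg]
    rw [this, Measure.prod_prod, measure_univ, mul_one, boolLaw_false]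
    have := prob_compl_eq_one_sub (μ := μ) (s := {Response.abstain}ᶜ) (MeasurableSet.of_discrete)
    rw [compl_compl] at this
    exact this.symm
  by_cases h2 : r = b
  · subst h2
    have : (fun x : Bool × Bool => mkResponse r g x.1 x.2) ⁻¹' {r} = {true} ×ˢ {true} := by
      ext ⟨a, z⟩; cases a <;> cases z <;> simp [mkResponse, hb.symm, hbg.symm]
    rw [this, Measure.prod_prod, boolLaw_true, boolLaw_true, hmb]
  · obtain rfl : r = g := by
      revert hb hg hbg h1 h2
      rcases b with _ | _ | _ <;> rcases g with _ | _ | _ <;> rcases r with _ | _ | _ <;> simp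
    have : (fun x : Bool × Bool => mkResponse b r x.1 x.2) ⁻¹' {r} = {true} ×ˢ {false} := by
      ext ⟨a, z⟩; cases a <;> cases z <;> simp [mkResponse, hg.symm, hbg]
    rw [this, Measure.prod_prod, boolLaw_true, boolLaw_false, ENNReal.mul_sub fun _ _ => hfin,
      hmb, mul_one, hs]
    exact ENNReal.add_sub_cancel_left (measure_ne_top _ _)

/-- Two independent i.i.d. sequences of Booleans, combined termwise. -/
lemma infinitePi_prod_map_mkResponse {α β : Measure Bool} [IsProbabilityMeasure α]
    [IsProbabilityMeasure β] {μ : Measure Response} [IsProbabilityMeasure μ] {b g : Response}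
    (h : (α.prod β).map (fun x => mkResponse b g x.1 x.2) = μ) :
    ((Measure.infinitePi fun _ : ℕ => α).prod (Measure.infinitePi fun _ : ℕ => β)).map
      (fun x i => mkResponse b g (x.1 i) (x.2 i)) = Measure.infinitePi fun _ : ℕ => μ := by
  -- Both sides are images of one product measure on Bool × ℕ, curried in the two possible orders.
  let κ : Bool → Measure Bool := fun c => if c then α else β
  have hκ : ∀ c, IsProbabilityMeasure (κ c) := fun c => by
    cases c <;> simp only [κ] <;> infer_instance
  have hF : Measurable fun x : Bool × Bool => mkResponse b g x.1 x.2 := by fun_prop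
  set T := Measure.infinitePi fun p : Bool × ℕ => κ p.1
  have h1 : T.map (fun ω => ((fun i => ω (true, i)), fun i => ω (false, i)))
      = (Measure.infinitePi fun _ : ℕ => α).prod (Measure.infinitePi fun _ : ℕ => β) := by
    have e1 := Measure.infinitePi_map_curry (fun (c : Bool) (_ : ℕ) => κ c)
    have e2 := Measure.infinitePi_map_eval_prod
      (P := fun c : Bool => Measure.infinitePi fun _ : ℕ => κ c) (i := true) (j := false) (by simp)
    rw [← e1, Measure.map_map (by fun_prop) (by fun_prop)] at e2
    exact e2
  have h2 : T.map (fun ω i => mkResponse b g (ω (true, i)) (ω (false, i)))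
      = Measure.infinitePi fun _ : ℕ => μ := by
    have e0 := Measure.map_infinitePi_infinitePi_of_inj (P := fun p : Bool × ℕ => κ p.1)
      (f := fun q : ℕ × Bool => (q.2, q.1)) (fun q q' hq => by
        simp only [Prod.mk.injEq] at hq; exact Prod.ext hq.2 hq.1)
    have e1 := Measure.infinitePi_map_curry (fun (_ : ℕ) (c : Bool) => κ c)
    have e3 := Measure.infinitePi_map_pi (fun _ : ℕ => Measure.infinitePi fun c : Bool => κ c)
      (f := fun _ : ℕ => fun x : Bool → Bool => mkResponse b g (x true) (x false))
      (fun _ => hF.comp (by fun_prop : Measurable fun x : Bool → Bool => (x true, x false)))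
    have e4 : (Measure.infinitePi fun c : Bool => κ c).map
        (fun x : Bool → Bool => mkResponse b g (x true) (x false)) = μ := by
      have e2 := Measure.infinitePi_map_eval_prod (P := κ) (i := true) (j := false) (by simp)
      rw [← h, show α = κ true from rfl, show β = κ false from rfl, ← e2,
        Measure.map_map hF (by fun_prop)]
      rfl
    have hm : Measurable fun (x : ℕ → Bool → Bool) (i : ℕ) =>
        mkResponse b g (x i true) (x i false) := measurable_pi_iff.2 fun i =>
      hF.comp (by fun_prop : Measurable fun x : ℕ → Bool → Bool => (x i true, x i false))
    rw [← e1, ← e0, Measure.map_map hm (by fun_prop),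
      Measure.map_map (hm.comp (by fun_prop)) (by fun_prop)] at e3
    simp only [e4] at e3
    exact e3
  have hm : Measurable fun (x : (ℕ → Bool) × (ℕ → Bool)) (i : ℕ) =>
      mkResponse b g (x.1 i) (x.2 i) := measurable_pi_iff.2 fun i =>
    hF.comp (by fun_prop : Measurable fun x : (ℕ → Bool) × (ℕ → Bool) => (x.1 i, x.2 i))
  rw [← h1, Measure.map_map hm (by fun_prop)]
  exact h2

lemma filter_range_eq_map_nth (p : ℕ → Prop) [DecidablePred p] (n : ℕ) :
    (List.range n).filter p = (List.range (Nat.count p n)).map (Nat.nth p) := by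
  induction n with
  | zero => simp
  | succ n ih =>
    rw [List.range_succ, List.filter_append, ih, Nat.count_succ]
    by_cases h : p n
    · simp [h, List.range_succ, Nat.nth_count]
    · simp [h]

/-- The labels received form a subsequence whose index map depends only on the abstention pattern,
not on the values. -/
lemma filterMap_ite_eq_firstTerms (a : ℕ → Bool) (N : ℕ) :
    ∃ φ : ℕ → ℕ, Function.Injective φ ∧ ∀ v : ℕ → ℝ, ∀ n ≤ N, ∃ m,
      (List.range n).filterMap (fun i => if a i then some (v i) else none)
        = firstTerms (fun j => v (φ j)) m := by
  classical
  -- There may be only finitely many labels. Counting every index from N on as answered makes the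
  -- enumeration total and injective, without changing anything before N.
  let p : ℕ → Prop := fun i => a i = true ∨ N ≤ i
  have hinf : (Set.ofPred p).Infinite :=
    (Set.Ici_infinite N).mono fun i hi => Or.inr hi
  refine ⟨Nat.nth p, Nat.nth_injective hinf, fun v n hn => ⟨Nat.count p n, ?_⟩⟩
  have h1 : (List.range n).filterMap (fun i => if a i then some (v i) else none)
      = ((List.range n).filter p).map v := by
    rw [← List.filterMap_eq_map, List.filterMap_filter]
    refine List.filterMap_congr fun i hi => ?_
    have : ¬ N ≤ i := by have := List.mem_range.1 hi; omega
    simp [p, this]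
  rw [h1, filter_range_eq_map_nth, firstTerms, List.map_map]
  rfl

/-- The test sees only answered queries, a random number of them. Conditionally on the abstention
pattern, the labels seen are i.i.d. signs, and the half-mass hypothesis makes their mean
nonpositive. Truncation at N gives events that depend on finitely many responses. -/
lemma UniformBernstein.measure_labels_le {D₀ : ℝ} (h : UniformBernstein D₀)
    {μ : Measure Response} [IsProbabilityMeasure μ] {b g : Response}
    (hb : b ≠ .abstain) (hg : g ≠ .abstain) (hbg : b ≠ g)
    (hhalf : μ {b} ≤ 1 / 2 * μ {.abstain}ᶜ) {δ : ℝ} (hδ : 0 < δ) (hδ1 : δ < 1) :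
    Measure.infinitePi (fun _ : ℕ => μ) {y | ∃ n,
      CheckSignificant D₀ ((List.range n).filterMap fun i => signEntry b (y i)) δ}
      ≤ ENNReal.ofReal δ := by
  set E : ℕ → Set (ℕ → Response) := fun N => {y | ∃ n ≤ N,
    CheckSignificant D₀ ((List.range n).filterMap fun i => signEntry b (y i)) δ} with hE
  have hU : {y : ℕ → Response | ∃ n,
      CheckSignificant D₀ ((List.range n).filterMap fun i => signEntry b (y i)) δ} = ⋃ N, E N := by
    ext y
    simp only [hE, mem_ofPred_eq, mem_iUnion]
    exact ⟨fun ⟨n, hn⟩ => ⟨n, n, le_rfl, hn⟩, fun ⟨_, n, _, hn⟩ => ⟨n, hn⟩⟩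
  have hmono : Monotone E := fun N N' hN y ⟨n, hn, hy⟩ => ⟨n, hn.trans hN, hy⟩
  rw [hU, hmono.measure_iUnion]
  refine iSup_le fun N => ?_
  set θ := μ {b} / μ {.abstain}ᶜ with hθ
  have hθ2 : θ ≤ 1 / 2 := ENNReal.div_le_of_le_mul hhalf
  have hθ1 : θ ≤ 1 := hθ2.trans (by norm_num)
  have hα := isProbabilityMeasure_boolLaw (prob_le_one (μ := μ) (s := {.abstain}ᶜ))
  have hβ := isProbabilityMeasure_boolLaw hθ1
  have hlaw := infinitePi_prod_map_mkResponse (prod_boolLaw_map_mkResponse (μ := μ) hb hg hbg)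
  have hF : Measurable fun x : Bool × Bool => mkResponse b g x.1 x.2 := by fun_prop
  have hm : Measurable fun (x : (ℕ → Bool) × (ℕ → Bool)) (i : ℕ) =>
      mkResponse b g (x.1 i) (x.2 i) := measurable_pi_iff.2 fun i =>
    hF.comp (by fun_prop : Measurable fun x : (ℕ → Bool) × (ℕ → Bool) => (x.1 i, x.2 i))
  have hEm : MeasurableSet (E N) := by
    refine measurableSet_of_dependsOn_finset (Finset.range N)
      (fun i _ => measurable_pi_apply i) ?_
    rintro x y hxy ⟨n, hn, hx⟩
    refine ⟨n, hn, ?_⟩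
    convert hx using 1
    refine List.filterMap_congr fun i hi => ?_
    rw [hxy i (Finset.mem_range.2 (lt_of_lt_of_le (List.mem_range.1 hi) hn))]
  rw [← hlaw, Measure.map_apply hm hEm, Measure.prod_apply (hm hEm)]
  -- Fubini: the bound is proved for each fixed abstention pattern `a`.
  refine le_trans (lintegral_mono (g := fun _ => ENNReal.ofReal δ) fun a => ?_) (by simp)
  have hs : Measurable boolSign := by fun_prop
  have hνp : IsProbabilityMeasure ((boolLaw θ).map boolSign) :=
    Measure.isProbabilityMeasure_map hs.aemeasurable
  have hνb : ∀ᵐ x ∂(boolLaw θ).map boolSign, |x| ≤ 1 := by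
    refine (ae_map_iff hs.aemeasurable (measurableSet_le (by fun_prop) measurable_const)).2 ?_
    refine Filter.Eventually.of_forall fun z => ?_
    cases z <;> simp [boolSign]
  have hνm : ∫ x, x ∂(boolLaw θ).map boolSign ≤ 0 := by
    rw [integral_map hs.aemeasurable (by fun_prop), integral_fintype (Integrable.of_finite)]
    have h1 : (boolLaw θ).real {true} ≤ 1 / 2 := by
      rw [measureReal_def, boolLaw_true]
      simpa using ENNReal.toReal_mono (by norm_num) hθ2
    have h2 : (boolLaw θ).real {false} = 1 - (boolLaw θ).real {true} := by
      rw [measureReal_def, measureReal_def, boolLaw_true, boolLaw_false,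
        ENNReal.toReal_sub_of_le hθ1 (by simp), ENNReal.toReal_one]
    simp [boolSign, h2]
    linarith
  have hcheck := h.measure_checkSignificant_le hνb hνm hδ hδ1
  obtain ⟨φ, hφ, hlist⟩ := filterMap_ite_eq_firstTerms a N
  have hmap : (Measure.infinitePi fun _ : ℕ => boolLaw θ).map
      (fun z j => boolSign (z (φ j))) = Measure.infinitePi fun _ : ℕ => (boolLaw θ).map boolSign := by
    have e1 := Measure.infinitePi_map_pi (fun _ : ℕ => boolLaw θ) (fun _ => hs)
    have e2 := Measure.map_infinitePi_infinitePi_of_inj (P := fun _ : ℕ => boolLaw θ) hφ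
    rw [← e2, Measure.map_map (by fun_prop) (by fun_prop)] at e1
    exact e1
  rw [← hmap] at hcheck
  refine le_trans (measure_mono ?_) ((Measure.le_map_apply
    (Measurable.aemeasurable (by fun_prop)) _).trans hcheck)
  rintro z ⟨n, hn, hz⟩
  obtain ⟨m, hm'⟩ := hlist (fun i => boolSign (z i)) n hn
  refine ⟨m, ?_⟩
  rw [← hm']
  convert hz using 1
  refine List.filterMap_congr fun i _ => ?_
  exact (signEntry_mkResponse hb hg hbg (a i) (z i)).symm

/-! ## One round of the algorithm for thresholds -/

instance : Finite Quartile :=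
  Finite.of_injective (fun r : Quartile => (decide (r = .u), decide (r = .v))) (by
    rintro (_ | _ | _) (_ | _ | _) h <;> simp_all)

lemma aEntry_eq_indicator : aEntry = ({.abstain}ᶜ : Set Response).indicator (fun _ => (1 : ℝ)) := by
  ext r; rcases r with _ | _ | _ <;> simp [aEntry]

lemma integral_aEntry (μ : Measure Response) [IsProbabilityMeasure μ] :
    ∫ r, aEntry r ∂μ = 1 - μ.real {.abstain} := by
  rw [aEntry_eq_indicator, integral_indicator (MeasurableSet.of_discrete), setIntegral_const,
    probReal_compl_eq_one_sub (MeasurableSet.of_discrete), smul_eq_mul, mul_one]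

section

variable {ρ : Quartile → Measure Response} [∀ w, IsProbabilityMeasure (ρ w)]

/-- Each difference lies in {-1, 0, 1} and has mean ρ_m(⊥) - ρ_w(⊥), which is nonpositive when w
abstains at least as often as the midpoint. -/
lemma UniformEmpiricalBernstein.measure_aDiff_le {D₁ : ℝ} (h : UniformEmpiricalBernstein D₁)
    {w : Quartile} (hw : ρ .m {.abstain} ≤ ρ w {.abstain}) {δ : ℝ} (hδ : 0 < δ) (hδ1 : δ < 1) :
    Measure.infinitePi (fun p : ℕ × Quartile => ρ p.2)
      {X | ∃ n, 0 < n ∧ CheckSignificantVar D₁ (aDiff (fun i w => X (i, w)) w n) δ}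
      ≤ ENNReal.ofReal δ := by
  have hf : Measurable fun x : Quartile → Response => aEntry (x w) - aEntry (x .m) := by
    have : Measurable aEntry := by fun_prop
    fun_prop
  set ν := (Measure.infinitePi ρ).map fun x : Quartile → Response => aEntry (x w) - aEntry (x .m)
    with hν
  have hνp : IsProbabilityMeasure ν := Measure.isProbabilityMeasure_map hf.aemeasurable
  have hb : ∀ᵐ x ∂ν, |x| ≤ 1 := by
    refine (ae_map_iff hf.aemeasurable (measurableSet_le (by fun_prop) measurable_const)).2 ?_
    refine Filter.Eventually.of_forall fun x => ?_
    rcases x w with _ | _ | _ <;> rcases x .m with _ | _ | _ <;> simp [aEntry]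
  have hint : ∀ w, Integrable (fun x : Quartile → Response => aEntry (x w))
      (Measure.infinitePi ρ) := fun w => Integrable.of_finite
  have hev : ∀ w, ∫ x, aEntry (x w) ∂(Measure.infinitePi ρ) = 1 - (ρ w).real {.abstain} := by
    intro w
    rw [← integral_aEntry, ← Measure.infinitePi_map_eval ρ w,
      integral_map (Measurable.aemeasurable (by fun_prop))
        (Measurable.aestronglyMeasurable (by fun_prop))]
  have hmean : ∫ x, x ∂ν ≤ 0 := by
    rw [hν, integral_map hf.aemeasurable (by fun_prop), integral_sub (hint _) (hint _), hev, hev]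
    have := ENNReal.toReal_mono (measure_ne_top _ _) hw
    simp only [measureReal_def]
    linarith
  have hmap : (Measure.infinitePi fun p : ℕ × Quartile => ρ p.2).map
      (fun X i => aEntry (X (i, w)) - aEntry (X (i, .m))) = Measure.infinitePi fun _ : ℕ => ν := by
    have e1 := Measure.infinitePi_map_curry (fun (_ : ℕ) w => ρ w)
    have e2 := Measure.infinitePi_map_pi (fun _ : ℕ => Measure.infinitePi ρ) (fun _ => hf)
    have hm : Measurable fun (x : ℕ → Quartile → Response) i =>
        aEntry (x i w) - aEntry (x i .m) :=
      measurable_pi_iff.2 fun i => hf.comp (measurable_pi_apply i)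
    rw [← e1, Measure.map_map hm (by fun_prop)] at e2
    exact e2
  have hcheck := h.measure_checkSignificantVar_le hb hmean hδ hδ1
  rw [← hmap] at hcheck
  exact (Measure.le_map_apply (Measurable.aemeasurable (measurable_pi_iff.2 fun i =>
    hf.comp (by fun_prop : Measurable fun (X : ℕ × Quartile → Response) w => X (i, w)))) _).trans
    hcheck

lemma UniformBernstein.measure_quartile_labels_le {D₀ : ℝ} (h : UniformBernstein D₀) (w : Quartile)
    {b g : Response} (hb : b ≠ .abstain) (hg : g ≠ .abstain) (hbg : b ≠ g)
    (hhalf : ρ w {b} ≤ 1 / 2 * ρ w {.abstain}ᶜ) {δ : ℝ} (hδ : 0 < δ) (hδ1 : δ < 1) :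
    Measure.infinitePi (fun p : ℕ × Quartile => ρ p.2) {X | ∃ n,
      CheckSignificant D₀ ((List.range n).filterMap fun i => signEntry b (X (i, w))) δ}
      ≤ ENNReal.ofReal δ := by
  have hcheck := h.measure_labels_le hb hg hbg hhalf hδ hδ1
  have e2 := Measure.map_infinitePi_infinitePi_of_inj (P := fun p : ℕ × Quartile => ρ p.2)
    (f := fun i : ℕ => (i, w)) (fun i j hij => congrArg Prod.fst hij)
  rw [← e2] at hcheck
  exact (Measure.le_map_apply (f := fun (X : ℕ × Quartile → Response) (i : ℕ) => X (i, w))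
    (Measurable.aemeasurable (by fun_prop)) _).trans hcheck

end

lemma neg_bArray (X : ℕ → Quartile → Response) (w : Quartile) (n : ℕ) :
    (bArray X w n).map (fun b => -b)
      = (List.range n).filterMap fun i => signEntry .zero (X i w) := by
  rw [bArray, List.map_filterMap]
  refine List.filterMap_congr fun i _ => ?_
  rcases X i w with _ | _ | _ <;> simp [bEntry, signEntry]

lemma bArray_eq (X : ℕ → Quartile → Response) (w : Quartile) (n : ℕ) :
    bArray X w n = (List.range n).filterMap fun i => signEntry .one (X i w) := by
  rw [bArray]
  refine List.filterMap_congr fun i _ => ?_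
  rcases X i w with _ | _ | _ <;> simp [bEntry, signEntry]

lemma decision_eq_some {D₀ D₁ δ : ℝ} {I J : ℝ × ℝ} {X : ℕ → Quartile → Response} {n : ℕ}
    (h : decision D₀ D₁ δ I X n = some J) :
    (J = (Quartile.pos I .u, I.2) ∧ (CheckSignificantVar D₁ (aDiff X .u n) δ ∨
      CheckSignificant D₀ ((List.range n).filterMap fun i => signEntry .zero (X i .u)) δ)) ∨
    (J = (I.1, Quartile.pos I .v) ∧ (CheckSignificantVar D₁ (aDiff X .v n) δ ∨
      CheckSignificant D₀ ((List.range n).filterMap fun i => signEntry .one (X i .v)) δ)) := by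
  rw [← neg_bArray, ← bArray_eq]
  unfold decision at h
  split_ifs at h with h1 h2 h3 h4 <;> simp_all

lemma roundStep_eq_some_iff {D₀ D₁ δ : ℝ} {I J : ℝ × ℝ} {X : ℕ → Quartile → Response} :
    roundStep D₀ D₁ δ I X = some J ↔ ∃ n, 1 ≤ n ∧ decision D₀ D₁ δ I X n = some J ∧
      ∀ j < n, 1 ≤ j → decision D₀ D₁ δ I X j = none := by
  classical
  unfold roundStep
  constructor
  · intro h
    split_ifs at h with h1
    refine ⟨_, (Nat.find_spec h1).1, h, fun j hj hj1 => ?_⟩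
    have := Nat.find_min h1 hj
    simpa [hj1] using this
  · rintro ⟨n, hn, hJ, hmin⟩
    have h1 : ∃ n : ℕ, 1 ≤ n ∧ (decision D₀ D₁ δ I X n).isSome := ⟨n, hn, by simp [hJ]⟩
    rw [dif_pos h1]
    have : Nat.find h1 = n := by
      rw [Nat.find_eq_iff]
      exact ⟨⟨hn, by simp [hJ]⟩, fun j hj ⟨hj1, hj2⟩ => by simp [hmin j hj hj1] at hj2⟩
    rw [this, hJ]

lemma half_of_noise {m : ℕ} {g : (Fin m → ℝ) → ℝ} {L : Labeler m} (hL : LabelerCondition g L)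
    {x : Fin m → ℝ} (hx : x ∈ cube m) {t : ℝ} (ht : t ∈ Icc (0 : ℝ) 1) {b : Response}
    (hb : b ≠ .abstain) (hbt : b ≠ trueLabel g x t) :
    (L x t).toMeasure {b} ≤ 1 / 2 * (L x t).toMeasure {.abstain}ᶜ := by
  have h := hL.noise x hx t ht
  have hs : {y : Response | y ≠ .abstain} = {.abstain}ᶜ := rfl
  rw [hs, ProbabilityTheory.cond_apply (MeasurableSet.of_discrete)] at h
  have h1 : (L x t).toMeasure {b} ≤
      (L x t).toMeasure ({.abstain}ᶜ ∩ {y | y ≠ trueLabel g x t}) :=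
    measure_mono (by rintro r rfl; exact ⟨hb, hbt⟩)
  -- With almost sure abstention the conditional law is the zero measure and says nothing, but then
  -- both sides of the claim vanish.
  rcases eq_or_ne ((L x t).toMeasure {.abstain}ᶜ) 0 with h0 | h0
  · rw [h0, mul_zero, nonpos_iff_eq_zero]
    exact measure_mono_null (by simpa using hb.symm) h0
  refine h1.trans ?_
  rw [mul_comm, ← div_eq_mul_inv] at h
  exact (ENNReal.div_le_iff h0 (measure_ne_top _ _)).1 h

/-- A round loses the boundary only if one of two tests with a false hypothesis accepts. -/
lemma measure_roundStep_wrong_le {m : ℕ} {g : (Fin m → ℝ) → ℝ} {L : Labeler m}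
    (hL : LabelerCondition g L) {x : Fin m → ℝ} (hx : x ∈ cube m) {D₀ D₁ : ℝ}
    (h0 : UniformBernstein D₀) (h1 : UniformEmpiricalBernstein D₁) {δ : ℝ} (hδ : 0 < δ)
    (hδ1 : δ < 1) {I : ℝ × ℝ} (hI0 : 0 ≤ I.1) (hI : I.1 ≤ I.2) (hI1 : I.2 ≤ 1)
    (hg : g x ∈ Icc I.1 I.2) :
    Measure.infinitePi (fun p : ℕ × Quartile => (L x (Quartile.pos I p.2)).toMeasure)
      {X | ∃ J, roundStep D₀ D₁ δ I (fun i w => X (i, w)) = some J ∧ g x ∉ Icc J.1 J.2}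
      ≤ ENNReal.ofReal δ + ENNReal.ofReal δ := by
  have hpos : ∀ w, Quartile.pos I w ∈ Icc (0 : ℝ) 1 := by
    intro w; cases w <;> simp only [Quartile.pos] <;> constructor <;> linarith
  let ρ : Quartile → Measure Response := fun w => (L x (Quartile.pos I w)).toMeasure
  have habst : ∀ w, |Quartile.pos I w - g x| ≤ |Quartile.pos I .m - g x| →
      ρ .m {.abstain} ≤ ρ w {.abstain} := by
    intro w hw
    simp only [ρ, PMF.toMeasure_apply_singleton _ _ (MeasurableSet.of_discrete)]
    exact hL.abstention x hx _ (hpos .m) _ (hpos w) hw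
  obtain ⟨hg1, hg2⟩ := hg
  -- Left of U only the move to [U, R] is harmful. There U is closer to the boundary than M, and the
  -- true label at U is 1.
  rcases lt_or_ge (g x) (Quartile.pos I .u) with hu | hu
  · have hlab : trueLabel g x (Quartile.pos I .u) = .one := by simp [trueLabel, hu]
    have hA := h1.measure_aDiff_le (ρ := ρ) (w := .u) (habst .u (by
      simp only [Quartile.pos] at *
      rw [abs_of_nonneg (by linarith), abs_of_nonneg (by linarith)]; linarith)) hδ hδ1
    have hB := h0.measure_quartile_labels_le (ρ := ρ) .u (b := .zero) (g := .one) (by simp) (by simp)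
      (by simp) (half_of_noise hL hx (hpos .u) (by simp) (by simp [hlab])) hδ hδ1
    refine le_trans (measure_mono ?_) ((measure_union_le _ _).trans (add_le_add hA hB))
    rintro X ⟨J, hJ, hgJ⟩
    obtain ⟨n, hn, hd, -⟩ := roundStep_eq_some_iff.1 hJ
    rcases decision_eq_some hd with ⟨-, h | h⟩ | ⟨rfl, -⟩
    · exact Or.inl ⟨n, hn, h⟩
    · exact Or.inr ⟨n, h⟩
    · refine absurd ⟨hg1, ?_⟩ hgJ
      simp only [Quartile.pos] at *
      linarith
  rcases lt_or_ge (Quartile.pos I .v) (g x) with hv | hv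
  · have hlab : trueLabel g x (Quartile.pos I .v) = .zero := by simp [trueLabel, hv.le]
    have hA := h1.measure_aDiff_le (ρ := ρ) (w := .v) (habst .v (by
      simp only [Quartile.pos] at *
      rw [abs_of_nonpos (by linarith), abs_of_nonpos (by linarith)]; linarith)) hδ hδ1
    have hB := h0.measure_quartile_labels_le (ρ := ρ) .v (b := .one) (g := .zero) (by simp) (by simp)
      (by simp) (half_of_noise hL hx (hpos .v) (by simp) (by simp [hlab])) hδ hδ1
    refine le_trans (measure_mono ?_) ((measure_union_le _ _).trans (add_le_add hA hB))
    rintro X ⟨J, hJ, hgJ⟩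
    obtain ⟨n, hn, hd, -⟩ := roundStep_eq_some_iff.1 hJ
    rcases decision_eq_some hd with ⟨rfl, -⟩ | ⟨-, h | h⟩
    · exact absurd ⟨hu, hg2⟩ hgJ
    · exact Or.inl ⟨n, hn, h⟩
    · exact Or.inr ⟨n, h⟩
  -- Between U and V both moves keep the boundary.
  · refine le_trans (le_of_eq (measure_mono_null ?_ measure_empty)) zero_le
    rintro X ⟨J, hJ, hgJ⟩
    obtain ⟨n, hn, hd, -⟩ := roundStep_eq_some_iff.1 hJ
    rcases decision_eq_some hd with ⟨rfl, -⟩ | ⟨rfl, -⟩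
    · exact hgJ ⟨hu, hg2⟩
    · exact hgJ ⟨hg1, hv⟩

/-! ## The algorithm for thresholds on one line -/

open Classical in
/-- The intervals that can occur after `k` rounds. -/
def candidates : ℕ → Finset (ℝ × ℝ)
  | 0 => {(0, 1)}
  | k + 1 => (candidates k).image (fun I => (Quartile.pos I .u, I.2)) ∪
      (candidates k).image (fun I => (I.1, Quartile.pos I .v))

lemma mem_candidates_succ {k : ℕ} {I J : ℝ × ℝ} (hI : I ∈ candidates k)
    (hJ : J = (Quartile.pos I .u, I.2) ∨ J = (I.1, Quartile.pos I .v)) :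
    J ∈ candidates (k + 1) := by
  simp only [candidates, Finset.mem_union, Finset.mem_image]
  rcases hJ with rfl | rfl
  · exact Or.inl ⟨I, hI, rfl⟩
  · exact Or.inr ⟨I, hI, rfl⟩

lemma bounds_of_mem_candidates {k : ℕ} : ∀ {I : ℝ × ℝ}, I ∈ candidates k →
    0 ≤ I.1 ∧ I.2 ≤ 1 ∧ I.2 - I.1 = (3 / 4) ^ k := by
  induction k with
  | zero => intro I hI; simp only [candidates, Finset.mem_singleton] at hI; subst hI; norm_num
  | succ k ih =>
    intro I hI
    simp only [candidates, Finset.mem_union, Finset.mem_image] at hI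
    have hp : (0 : ℝ) < (3 / 4) ^ k := by positivity
    rw [pow_succ]
    rcases hI with ⟨J, hJ, rfl⟩ | ⟨J, hJ, rfl⟩ <;> obtain ⟨h1, h2, h3⟩ := ih hJ <;>
      simp only [Quartile.pos] <;> refine ⟨?_, ?_, ?_⟩ <;> linarith

lemma roundStep_cases {D₀ D₁ δ : ℝ} {I J : ℝ × ℝ} {X : ℕ → Quartile → Response}
    (h : roundStep D₀ D₁ δ I X = some J) :
    J = (Quartile.pos I .u, I.2) ∨ J = (I.1, Quartile.pos I .v) := by
  obtain ⟨n, -, hd, -⟩ := roundStep_eq_some_iff.1 h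
  rcases decision_eq_some hd with ⟨h, -⟩ | ⟨h, -⟩
  · exact Or.inl h
  · exact Or.inr h

lemma intervalAfter_succ_eq_some {D₀ D₁ δ' : ℝ} {Y : ℕ → ℕ → Quartile → ℝ → Response} {k : ℕ}
    {J : ℝ × ℝ} : intervalAfter D₀ D₁ δ' Y (k + 1) = some J ↔
      ∃ I, intervalAfter D₀ D₁ δ' Y k = some I ∧
        roundStep D₀ D₁ δ' I (fun i w => Y k i w (Quartile.pos I w)) = some J := by
  rw [intervalAfter, Option.bind_eq_some_iff]

lemma mem_candidates_of_intervalAfter {D₀ D₁ δ' : ℝ} {Y : ℕ → ℕ → Quartile → ℝ → Response}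
    {k : ℕ} : ∀ {I : ℝ × ℝ}, intervalAfter D₀ D₁ δ' Y k = some I → I ∈ candidates k := by
  induction k with
  | zero => intro I h; simp only [intervalAfter, Option.some.injEq] at h; simp [candidates, h]
  | succ k ih =>
    intro J h
    obtain ⟨I, hI, hJ⟩ := intervalAfter_succ_eq_some.1 h
    exact mem_candidates_succ (ih hI) (roundStep_cases hJ)

lemma decision_congr {D₀ D₁ δ : ℝ} {I : ℝ × ℝ} {X X' : ℕ → Quartile → Response} {n : ℕ}
    (h : ∀ i < n, ∀ w, X i w = X' i w) : decision D₀ D₁ δ I X n = decision D₀ D₁ δ I X' n := by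
  have hA : ∀ w, aDiff X w n = aDiff X' w n := fun w =>
    List.map_congr_left fun i hi => by
      rw [h i (List.mem_range.1 hi), h i (List.mem_range.1 hi)]
  have hB : ∀ w, bArray X w n = bArray X' w n := fun w =>
    List.filterMap_congr fun i hi => by rw [h i (List.mem_range.1 hi)]
  unfold decision
  rw [hA .u, hA .v, hB .u, hB .v]

/-! ### Measurability and independence of the rounds -/

section

variable {m M : ℕ} (D₀ D₁ δ : ℝ) (l : Grid m M)

/-- The σ-algebra of the responses on the line `l` in the rounds from the set `s`. -/
abbrev sigmaRounds (s : Set ℕ) : MeasurableSpace (Slot m M → Response) :=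
  ⨆ p ∈ {p : Slot m M | p.1 = l ∧ p.2.1 ∈ s},
    MeasurableSpace.comap (fun ω : Slot m M → Response => ω p) inferInstance

lemma sigmaRounds_le (s : Set ℕ) : sigmaRounds l s ≤ MeasurableSpace.pi :=
  iSup₂_le fun p _ => (measurable_pi_apply p).comap_le

lemma measurable_response {s : Set ℕ} {k : ℕ} (hk : k ∈ s) (q : ℕ × Quartile × ℝ) :
    Measurable[sigmaRounds l s] fun ω : Slot m M → Response => ω (l, k, q) := by
  have hle : MeasurableSpace.comap (fun ω : Slot m M → Response => ω (l, k, q)) inferInstance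
      ≤ sigmaRounds l s := le_iSup₂_of_le (l, k, q) ⟨rfl, hk⟩ le_rfl
  exact Measurable.mono (comap_measurable _) hle le_rfl

/-- The responses used in round `k` on the line `l` if the current interval is `I`. -/
def roundResponses (k : ℕ) (I : ℝ × ℝ) (ω : Slot m M → Response) : ℕ → Quartile → Response :=
  fun i w => ω (l, k, i, w, Quartile.pos I w)

/-- The interval on the line `l` after `k` rounds. -/
def lineInterval (k : ℕ) (ω : Slot m M → Response) : Option (ℝ × ℝ) :=
  intervalAfter D₀ D₁ δ (fun k i w t => ω (l, k, i, w, t)) k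

lemma measurableSet_roundStep {s : Set ℕ} {k : ℕ} (hk : k ∈ s) (I J : ℝ × ℝ) :
    MeasurableSet[sigmaRounds l s]
      {ω | roundStep D₀ D₁ δ I (roundResponses l k I ω) = some J} := by
  classical
  simp only [roundStep_eq_some_iff, ofPred_exists]
  refine MeasurableSet.iUnion fun n => ?_
  refine measurableSet_of_dependsOn_finset ((Finset.range n ×ˢ
    {Quartile.u, Quartile.m, Quartile.v}).image
      fun p => ((l, k, p.1, p.2, Quartile.pos I p.2) : Slot m M)) ?_ ?_
  · intro p hp
    obtain ⟨q, -, rfl⟩ := Finset.mem_image.1 hp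
    exact measurable_response l hk _
  · intro ω ω' h
    have hX : ∀ i < n, ∀ w, roundResponses l k I ω i w = roundResponses l k I ω' i w := by
      intro i hi w
      refine h _ (Finset.mem_image.2 ⟨(i, w), ?_, rfl⟩)
      cases w <;> simp [hi]
    rintro ⟨hn, hd, hmin⟩
    refine ⟨hn, ?_, fun j hj hj1 => ?_⟩
    · rw [← hd]; exact (decision_congr hX).symm
    · rw [← hmin j hj hj1]; exact (decision_congr fun i hi => hX i (hi.trans hj)).symm

lemma measurableSet_lineInterval (k : ℕ) : ∀ J : ℝ × ℝ, MeasurableSet[sigmaRounds l (Iio k)]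
    {ω : Slot m M → Response | lineInterval D₀ D₁ δ l k ω = some J} := by
  induction k with
  | zero => intro J; simp only [lineInterval, intervalAfter]; exact MeasurableSet.const _
  | succ k ih =>
    intro J
    have hle : sigmaRounds l (Iio k) ≤ sigmaRounds l (Iio (k + 1)) :=
      biSup_mono fun p hp => ⟨hp.1, lt_trans hp.2 (Nat.lt_succ_self k)⟩
    have : {ω : Slot m M → Response | lineInterval D₀ D₁ δ l (k + 1) ω = some J}
        = ⋃ I ∈ candidates k, {ω | lineInterval D₀ D₁ δ l k ω = some I} ∩
          {ω | roundStep D₀ D₁ δ I (roundResponses l k I ω) = some J} := by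
      ext ω
      simp only [lineInterval, mem_ofPred_eq, intervalAfter_succ_eq_some, mem_iUnion, mem_inter_iff,
        exists_prop]
      exact ⟨fun ⟨I, hI, hJ⟩ => ⟨I, mem_candidates_of_intervalAfter hI, hI, hJ⟩,
        fun ⟨I, _, hI, hJ⟩ => ⟨I, hI, hJ⟩⟩
    rw [this]
    refine Finset.measurableSet_biUnion _ fun I _ => ?_
    exact (hle _ (ih I)).inter (measurableSet_roundStep D₀ D₁ δ l (mem_Iio.2 k.lt_succ_self) I J)

/-- The event that round `k` moves from the interval `I` to an interval without `y`. -/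
def wrongMove (y : ℝ) (k : ℕ) (I : ℝ × ℝ) : Set (Slot m M → Response) :=
  {ω | ∃ J, roundStep D₀ D₁ δ I (roundResponses l k I ω) = some J ∧ y ∉ Icc J.1 J.2}

lemma measurableSet_wrongMove (y : ℝ) (k : ℕ) (I : ℝ × ℝ) :
    MeasurableSet[sigmaRounds l {k}] (wrongMove D₀ D₁ δ l y k I) := by
  have : wrongMove D₀ D₁ δ l y k I =
      ⋃ J ∈ ({(Quartile.pos I .u, I.2), (I.1, Quartile.pos I .v)} : Set (ℝ × ℝ)),
        {ω | roundStep D₀ D₁ δ I (roundResponses l k I ω) = some J} ∩ {_ω | y ∉ Icc J.1 J.2} := by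
    ext ω
    simp only [wrongMove, mem_ofPred_eq, mem_iUnion, mem_inter_iff, exists_prop]
    exact ⟨fun ⟨J, hJ, hy⟩ => ⟨J, roundStep_cases hJ, hJ, hy⟩, fun ⟨J, _, hJ, hy⟩ => ⟨J, hJ, hy⟩⟩
  rw [this]
  refine MeasurableSet.biUnion (Set.toFinite _).countable fun J _ => ?_
  exact (measurableSet_roundStep D₀ D₁ δ l (mem_singleton k) I J).inter (MeasurableSet.const _)

instance (L : Labeler m) : IsProbabilityMeasure (responseLaw M L) := by
  unfold responseLaw; infer_instance

lemma indep_sigmaRounds (L : Labeler m) {s t : Set ℕ} (hst : Disjoint s t) :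
    ProbabilityTheory.Indep (sigmaRounds l s) (sigmaRounds l t) (responseLaw M L) := by
  have hind := (ProbabilityTheory.iIndepFun_infinitePi
    (P := fun p : Slot m M => (L (gridPoint p.1) p.2.2.2.2).toMeasure)
    (X := fun _ => (id : Response → Response)) (fun _ => measurable_id)).iIndep
  refine ProbabilityTheory.indep_iSup_of_disjoint (fun i => (measurable_pi_apply i).comap_le) hind ?_
  rw [Set.disjoint_left]
  exact fun p hp hp' => Set.disjoint_left.1 hst hp.2 hp'.2

variable {D₀ D₁ δ} {g : (Fin m → ℝ) → ℝ} {L : Labeler m}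

lemma gridPoint_mem_cube (l : Grid m M) : gridPoint l ∈ cube m := by
  refine ⟨fun i => by simp only [gridPoint, Pi.zero_apply]; positivity, fun i => ?_⟩
  simp only [gridPoint, Pi.one_apply]
  refine div_le_one_of_le₀ ?_ (by positivity)
  exact_mod_cast Nat.lt_succ_iff.1 (l i).2

/-- For a fixed interval the slots of round k are distinct for distinct (i, w), so their responses
have a product law and the single-round bound applies. -/
lemma measure_wrongMove_le (hL : LabelerCondition g L) (h0 : UniformBernstein D₀)
    (h1 : UniformEmpiricalBernstein D₁) (hδ : 0 < δ) (hδ1 : δ < 1) {k : ℕ} {I : ℝ × ℝ}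
    (hI : I ∈ candidates k) (hg : g (gridPoint l) ∈ Icc I.1 I.2) :
    responseLaw M L (wrongMove D₀ D₁ δ l (g (gridPoint l)) k I) ≤ 2 * ENNReal.ofReal δ := by
  obtain ⟨hb1, hb2, -⟩ := bounds_of_mem_candidates hI
  have h := measure_roundStep_wrong_le hL (gridPoint_mem_cube l) h0 h1 hδ hδ1 hb1
    (hg.1.trans hg.2) hb2 hg
  have hinj : Function.Injective
      fun p : ℕ × Quartile => ((l, k, p.1, p.2, Quartile.pos I p.2) : Slot m M) := by
    intro p q hpq
    simp only [Prod.mk.injEq, true_and] at hpq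
    exact Prod.ext hpq.1 hpq.2.1
  have hmap := Measure.map_infinitePi_infinitePi_of_inj
    (P := fun p : Slot m M => (L (gridPoint p.1) p.2.2.2.2).toMeasure) hinj
  rw [← hmap, ← two_mul] at h
  exact (Measure.le_map_apply (f := fun (ω : Slot m M → Response) (p : ℕ × Quartile) =>
    ω (l, k, p.1, p.2, Quartile.pos I p.2)) (Measurable.aemeasurable (by fun_prop)) _).trans h

/-- The event that round `k` loses `y`. -/
def lostAt (D₀ D₁ δ : ℝ) (l : Grid m M) (y : ℝ) (k : ℕ) : Set (Slot m M → Response) :=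
  {ω | ∃ I, lineInterval D₀ D₁ δ l k ω = some I ∧ y ∈ Icc I.1 I.2 ∧
    ω ∈ wrongMove D₀ D₁ δ l y k I}

/-- Adaptivity costs nothing: the interval reached depends on rounds before k, the wrong move from a
fixed interval only on round k. The events of reaching the various intervals are disjoint, so their
probabilities sum to at most 1 and the uniform bound survives. -/
lemma measure_lostAt_le (hL : LabelerCondition g L) (h0 : UniformBernstein D₀)
    (h1 : UniformEmpiricalBernstein D₁) (hδ : 0 < δ) (hδ1 : δ < 1) (k : ℕ) :
    responseLaw M L (lostAt D₀ D₁ δ l (g (gridPoint l)) k) ≤ 2 * ENNReal.ofReal δ := by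
  classical
  set P := responseLaw M L
  set y := g (gridPoint l)
  let E : ℝ × ℝ → Set (Slot m M → Response) := fun I => {ω | lineInterval D₀ D₁ δ l k ω = some I}
  let T := (candidates k).filter fun I => y ∈ Icc I.1 I.2
  have hsub : lostAt D₀ D₁ δ l y k ⊆ ⋃ I ∈ T, E I ∩ wrongMove D₀ D₁ δ l y k I := by
    rintro ω ⟨I, hI, hy, hw⟩
    refine mem_biUnion (x := I) ?_ ⟨hI, hw⟩
    exact Finset.mem_coe.2 (Finset.mem_filter.2 ⟨mem_candidates_of_intervalAfter hI, hy⟩)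
  have hind := indep_sigmaRounds l L (s := Iio k) (t := {k}) (by simp)
  have hE : ∀ I, MeasurableSet (E I) := fun I =>
    sigmaRounds_le l _ _ (measurableSet_lineInterval D₀ D₁ δ l k I)
  calc P (lostAt D₀ D₁ δ l y k) ≤ ∑ I ∈ T, P (E I ∩ wrongMove D₀ D₁ δ l y k I) :=
        (measure_mono hsub).trans (measure_biUnion_finset_le _ _)
    _ ≤ ∑ I ∈ T, P (E I) * (2 * ENNReal.ofReal δ) := by
        refine Finset.sum_le_sum fun I hI => ?_
        rw [(ProbabilityTheory.Indep_iff _ _ _).1 hind _ _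
          (measurableSet_lineInterval D₀ D₁ δ l k I) (measurableSet_wrongMove D₀ D₁ δ l y k I)]
        gcongr
        obtain ⟨hI, hy⟩ := Finset.mem_filter.1 hI
        exact measure_wrongMove_le l hL h0 h1 hδ hδ1 hI hy
    _ = P (⋃ I ∈ T, E I) * (2 * ENNReal.ofReal δ) := by
        rw [← Finset.sum_mul, measure_biUnion_finset ?_ fun I _ => hE I]
        intro I _ J _ hIJ
        refine Set.disjoint_left.2 fun ω (hI : _ = _) (hJ : _ = _) => hIJ ?_
        exact Option.some.inj (hI.symm.trans hJ)
    _ ≤ 2 * ENNReal.ofReal δ := mul_le_of_le_one_left' prob_le_one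

lemma mem_of_lineInterval {y : ℝ} (hy : y ∈ Icc (0 : ℝ) 1) {ω : Slot m M → Response} {N : ℕ}
    (h : ∀ k < N, ω ∉ lostAt D₀ D₁ δ l y k) : ∀ k ≤ N, ∀ I,
      lineInterval D₀ D₁ δ l k ω = some I → y ∈ Icc I.1 I.2 := by
  intro k
  induction k with
  | zero =>
    intro _ I hI
    simp only [lineInterval, intervalAfter, Option.some.injEq] at hI
    rw [← hI]; exact hy
  | succ k ih =>
    intro hk J hJ
    obtain ⟨I, hI, hIJ⟩ := intervalAfter_succ_eq_some.1 hJ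
    by_contra hcon
    exact h k hk ⟨I, hI, ih (by omega) I hI, J, hIJ, hcon⟩

end

lemma three_quarters_pow_numRounds_le {ε : ℝ} (hε : 0 < ε) :
    (3 / 4 : ℝ) ^ numRounds ε ≤ 2 * ε := by
  have h1 : Real.logb (4 / 3) (1 / (2 * ε)) ≤ numRounds ε := Nat.le_ceil _
  rw [Real.logb_le_iff_le_rpow (by norm_num) (by positivity), Real.rpow_natCast] at h1
  have h2 : (3 / 4 : ℝ) ^ numRounds ε * (4 / 3) ^ numRounds ε = 1 := by
    rw [← mul_pow]; norm_num
  rw [div_le_iff₀ (by positivity)] at h1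
  nlinarith [show (0 : ℝ) < (3 / 4) ^ numRounds ε by positivity]

section

variable {m M : ℕ} {g : (Fin m → ℝ) → ℝ} {L : Labeler m}

/-- The event that the run on the line `l` stops with an error above `ε`. -/
def lineFailure (D₀ D₁ ε δ : ℝ) (g : (Fin m → ℝ) → ℝ) (l : Grid m M) :
    Set (Slot m M → Response) :=
  {ω | ∃ v, learnThreshold D₀ D₁ ε δ (fun k i w t => ω (l, k, i, w, t)) = some v ∧
    ε < |v - g (gridPoint l)|}

lemma measure_lineFailure_le (hL : LabelerCondition g L) {D₀ D₁ : ℝ} (h0 : UniformBernstein D₀)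
    (h1 : UniformEmpiricalBernstein D₁) {ε δ : ℝ} (hε : 0 < ε) (hδ : 0 < δ) (hδ1 : δ ≤ 1)
    (l : Grid m M) (hg : g (gridPoint l) ∈ Icc (0 : ℝ) 1) :
    responseLaw M L (lineFailure D₀ D₁ ε δ g l) ≤ ENNReal.ofReal (δ / 2) := by
  set N := numRounds ε with hN
  set δ' := δ / (4 * (N : ℝ)) with hδ'
  have hsub : lineFailure D₀ D₁ ε δ g l ⊆
      ⋃ k ∈ Finset.range N, lostAt D₀ D₁ δ' l (g (gridPoint l)) k := by
    rintro ω ⟨v, hv, herr⟩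
    by_contra hcon
    simp only [mem_iUnion, Finset.mem_range, not_exists] at hcon
    rw [learnThreshold, Option.map_eq_some_iff] at hv
    obtain ⟨I, hI, rfl⟩ := hv
    have hmem := mem_of_lineInterval l hg hcon N le_rfl I hI
    obtain ⟨-, -, hlen⟩ := bounds_of_mem_candidates (mem_candidates_of_intervalAfter hI)
    have hp := three_quarters_pow_numRounds_le hε
    -- The boundary lies in the last interval, whose half-length is at most ε.
    refine absurd herr (not_lt.2 (abs_le.2 ?_))
    constructor <;> linarith [hmem.1, hmem.2]
  refine (measure_mono hsub).trans ((measure_biUnion_finset_le _ _).trans ?_)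
  -- With no rounds the level δ/(4 · 0) is 0 by convention, but no test is made and the union is
  -- empty.
  rcases Nat.eq_zero_or_pos N with h | h
  · simp [h]
  have hN1 : (1 : ℝ) ≤ N := by exact_mod_cast h
  have hδ'0 : 0 < δ' := by positivity
  have hδ'1 : δ' < 1 := by rw [hδ', div_lt_one (by positivity)]; linarith
  refine (Finset.sum_le_card_nsmul _ _ _ fun k _ =>
    measure_lostAt_le l hL h0 h1 hδ'0 hδ'1 k).trans (le_of_eq ?_)
  rw [Finset.card_range, nsmul_eq_mul, ← ENNReal.ofReal_natCast,
    show (2 : ℝ≥0∞) = ENNReal.ofReal 2 by simp, ← ENNReal.ofReal_mul (by norm_num),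
    ← ENNReal.ofReal_mul (by positivity)]
  congr 1
  rw [hδ']
  field_simp
  norm_num

/-- With probability `1 - δ/2`, all the runs that stop have error at most `ε`. -/
lemma ofReal_le_measure_all_lines (hL : LabelerCondition g L) {D₀ D₁ : ℝ}
    (h0 : UniformBernstein D₀) (h1 : UniformEmpiricalBernstein D₁) {ε δ : ℝ} (hε : 0 < ε)
    (hδ : 0 < δ) (hδ1 : δ < 1) (hg : ∀ x ∈ cube m, g x ∈ Icc (0 : ℝ) 1)
    {S : Set (Slot m M → Response)}
    (hS : ∀ ω, (∀ l : Grid m M, ω ∉ lineFailure D₀ D₁ ε (δ / ((M : ℝ) + 1) ^ m) g l) → ω ∈ S) :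
    ENNReal.ofReal (1 - δ / 2) ≤ responseLaw M L S := by
  refine ofReal_one_sub_le_measure (by positivity)
    (t := ⋃ l : Grid m M, lineFailure D₀ D₁ ε (δ / ((M : ℝ) + 1) ^ m) g l) ?_ ?_
  · intro ω hω
    by_contra hcon
    simp only [mem_iUnion, not_exists] at hcon
    exact hω (hS ω hcon)
  · have hM : (1 : ℝ) ≤ ((M : ℝ) + 1) ^ m := one_le_pow₀ (by simp)
    refine (measure_iUnion_fintype_le _ _).trans ?_
    refine (Finset.sum_le_card_nsmul _ _ _ fun l _ => measure_lineFailure_le hL h0 h1 hε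
      (by positivity) (div_le_one_of_le₀ (hδ1.le.trans hM) (by positivity)) l
      (hg _ (gridPoint_mem_cube l))).trans (le_of_eq ?_)
    rw [nsmul_eq_mul, ← ENNReal.ofReal_natCast, ← ENNReal.ofReal_mul (by positivity)]
    congr 1
    simp
    field_simp

end

/-! ## Polynomial interpolation on a cell -/

/-- The one-dimensional Lagrange polynomial for the nodes `b/M, …, (b + γ)/M` and the node `a/M`. -/
def lagrangeOne (M γ b a : ℕ) (t : ℝ) : ℝ :=
  ∏ j ∈ (Finset.range (γ + 1)).filter (fun j => b + j ≠ a),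
    (t - ((b + j : ℕ) : ℝ) / M) / ((a : ℝ) / M - ((b + j : ℕ) : ℝ) / M)

lemma lagrangeQ_eq_prod {m M : ℕ} (γ : ℕ) (q : Fin m → Fin (M / γ)) (l : Grid m M) (x : Fin m → ℝ) :
    lagrangeQ γ q l x = ∏ i, lagrangeOne M γ (γ * (q i : ℕ)) (l i) (x i) := rfl

/-- Interpolation at γ + 1 nodes reproduces (X - t)^c for c ≤ γ, and evaluation at X = t leaves 0^c.
-/
lemma sum_pow_mul_lagrangeOne {M : ℕ} (hM : 0 < M) {γ c : ℕ} (hc : c ≤ γ) (b : ℕ) (t : ℝ) :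
    ∑ j ∈ Finset.range (γ + 1),
      (((b + j : ℕ) : ℝ) / M - t) ^ c * lagrangeOne M γ b (b + j) t = 0 ^ c := by
  have hM' : (M : ℝ) ≠ 0 := by exact_mod_cast hM.ne'
  let v : ℕ → ℝ := fun j => ((b + j : ℕ) : ℝ) / M
  have hv : Set.InjOn v (Finset.range (γ + 1) : Finset ℕ) := by
    intro i _ j _ hij
    simp only [v, div_left_inj' hM', Nat.cast_inj] at hij
    omega
  let f : Polynomial ℝ := (Polynomial.X - Polynomial.C t) ^ c
  have hf : f.degree < (Finset.range (γ + 1)).card := by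
    rw [Polynomial.degree_pow, Polynomial.degree_X_sub_C, Finset.card_range, nsmul_eq_mul, mul_one]
    exact_mod_cast Nat.lt_succ_of_le hc
  have h := congrArg (Polynomial.eval t) (Lagrange.eq_interpolate hv hf)
  rw [Lagrange.interpolate_apply, Polynomial.eval_finsetSum] at h
  simp only [f, Polynomial.eval_pow, Polynomial.eval_sub, Polynomial.eval_X, Polynomial.eval_C,
    sub_self, Polynomial.eval_mul] at h
  rw [h]
  refine Finset.sum_congr rfl fun j _ => ?_
  congr 1
  rw [lagrangeOne, Lagrange.basis, Polynomial.eval_prod]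
  refine Finset.prod_congr ?_ fun i _ => ?_
  · ext i
    simp only [Finset.mem_filter, Finset.mem_erase]
    constructor
    · exact fun ⟨h1, h2⟩ => ⟨fun h3 => h2 (by rw [h3]), h1⟩
    · exact fun ⟨h1, h2⟩ => ⟨h2, fun h3 => h1 (by omega)⟩
  · rw [Lagrange.basisDivisor]
    simp only [Polynomial.eval_mul, Polynomial.eval_sub, Polynomial.eval_X, Polynomial.eval_C, v]
    rw [div_eq_inv_mul]

section

variable {m M γ : ℕ}

open Classical in
/-- The grid points of a cell. -/
def cellGrid (γ : ℕ) (q : Fin m → Fin (M / γ)) : Finset (Grid m M) :=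
  Finset.univ.filter (fun l : Grid m M => gridPoint l ∈ cell γ q)

lemma mem_cellGrid (hM : 0 < M) {q : Fin m → Fin (M / γ)} {l : Grid m M} :
    l ∈ cellGrid γ q ↔ ∀ i, γ * (q i : ℕ) ≤ l i ∧ (l i : ℕ) ≤ γ * (q i : ℕ) + γ := by
  have hM' : (0 : ℝ) < M := by exact_mod_cast hM
  simp only [cellGrid, Finset.mem_filter, Finset.mem_univ, true_and, cell, mem_Icc, Pi.le_def,
    gridPoint, div_le_div_iff_of_pos_right hM', ← forall_and]
  refine forall_congr' fun i => and_congr ?_ ?_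
  · rw [mul_comm γ]; exact_mod_cast Iff.rfl
  · rw [mul_comm γ, ← Nat.succ_mul]; exact_mod_cast Iff.rfl

lemma cell_index_le (q : Fin (M / γ)) : γ * (q : ℕ) + γ ≤ M := by
  have h1 : (q : ℕ) + 1 ≤ M / γ := q.2
  calc γ * (q : ℕ) + γ = γ * ((q : ℕ) + 1) := by ring
    _ ≤ γ * (M / γ) := Nat.mul_le_mul_left _ h1
    _ ≤ M := Nat.mul_div_le M γ

lemma sum_cellGrid_prod (hM : 0 < M) (q : Fin m → Fin (M / γ)) (h : Fin m → ℕ → ℝ) :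
    ∑ l ∈ cellGrid γ q, ∏ i, h i (l i)
      = ∏ i, ∑ j ∈ Finset.range (γ + 1), h i (γ * (q i : ℕ) + j) := by
  classical
  have hset : cellGrid γ q = Fintype.piFinset fun i => Finset.univ.filter
      fun a : Fin (M + 1) => γ * (q i : ℕ) ≤ a ∧ (a : ℕ) ≤ γ * (q i : ℕ) + γ := by
    ext l
    simp [mem_cellGrid hM, Fintype.mem_piFinset]
  rw [hset, ← Finset.prod_univ_sum (t := fun i => Finset.univ.filter
    fun a : Fin (M + 1) => γ * (q i : ℕ) ≤ a ∧ (a : ℕ) ≤ γ * (q i : ℕ) + γ)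
    (f := fun i a => h i a)]
  refine Finset.prod_congr rfl fun i _ => ?_
  refine Finset.sum_bij' (fun a _ => (a : ℕ) - γ * (q i : ℕ))
    (fun j hj => ⟨γ * (q i : ℕ) + j, by
      have := cell_index_le (q i)
      have := Finset.mem_range.1 hj
      omega⟩) ?_ ?_ ?_ ?_ ?_
  · intro a ha
    have := (Finset.mem_filter.1 ha).2
    simp only [Finset.mem_range]; omega
  · intro j hj
    have := Finset.mem_range.1 hj
    simp only [Finset.mem_filter, Finset.mem_univ, true_and]
    omega
  · intro a ha
    have := (Finset.mem_filter.1 ha).2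
    ext; simp only; omega
  · intro j hj
    simp only; omega
  · intro a ha
    have := (Finset.mem_filter.1 ha).2
    congr 1; omega

lemma card_cellGrid (hM : 0 < M) (q : Fin m → Fin (M / γ)) :
    ((cellGrid γ q).card : ℝ) = ((γ : ℝ) + 1) ^ m := by
  simpa using sum_cellGrid_prod hM q fun _ _ => (1 : ℝ)

/-- Total degree at most γ bounds the degree in each variable by γ, so the sum factors into
one-dimensional ones with values 0^(c i). One of these vanishes unless k = 0. -/
lemma sum_monomial_mul_lagrangeQ (hM : 0 < M) (q : Fin m → Fin (M / γ)) {k : ℕ} (hk : k ≤ γ)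
    (f : Fin k → Fin m) (x : Fin m → ℝ) :
    ∑ l ∈ cellGrid γ q, (∏ s, (gridPoint l (f s) - x (f s))) * lagrangeQ γ q l x
      = if k = 0 then 1 else 0 := by
  classical
  let c : Fin m → ℕ := fun i => (Finset.univ.filter fun s => f s = i).card
  have hc : ∀ i, c i ≤ γ := fun i => by
    refine ((Finset.card_filter_le _ _).trans ?_).trans hk
    simp
  have hmono : ∀ l : Grid m M, (∏ s, (gridPoint l (f s) - x (f s)))
      = ∏ i, (((l i : ℕ) : ℝ) / M - x i) ^ c i := by
    intro l
    refine (Finset.prod_fiberwise' (Finset.univ : Finset (Fin k)) f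
      (fun i => ((l i : ℕ) : ℝ) / M - x i)).symm.trans ?_
    exact Finset.prod_congr rfl fun i _ => by rw [Finset.prod_const]
  have h := sum_cellGrid_prod hM q fun i a =>
    ((a : ℝ) / M - x i) ^ c i * lagrangeOne M γ (γ * (q i : ℕ)) a (x i)
  calc _ = ∑ l ∈ cellGrid γ q, ∏ i, ((((l i : ℕ) : ℝ) / M - x i) ^ c i *
        lagrangeOne M γ (γ * (q i : ℕ)) (l i) (x i)) := by
        refine Finset.sum_congr rfl fun l _ => ?_
        rw [hmono, lagrangeQ_eq_prod, Finset.prod_mul_distrib]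
    _ = ∏ i, (0 : ℝ) ^ c i := by
        rw [h]
        exact Finset.prod_congr rfl fun i _ => sum_pow_mul_lagrangeOne hM (hc i) _ _
    _ = _ := by
        split_ifs with h0
        · subst h0
          refine Finset.prod_eq_one fun i _ => ?_
          simp [c]
        · have : 0 < k := Nat.pos_of_ne_zero h0
          refine Finset.prod_eq_zero (Finset.mem_univ (f ⟨0, this⟩)) (zero_pow ?_)
          exact Finset.card_ne_zero.2 ⟨⟨0, this⟩, by simp⟩

lemma multilinear_diag_eq_sum {k : ℕ} (T : ContinuousMultilinearMap ℝ (fun _ : Fin k => Fin m → ℝ) ℝ)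
    (v : Fin m → ℝ) : T (fun _ => v)
      = ∑ f : Fin k → Fin m, (∏ s, v (f s)) * T (fun s => Pi.single (f s) 1) := by
  have hv : v = ∑ i, v i • (Pi.single i 1 : Fin m → ℝ) := by
    ext j; simp [Finset.sum_apply, Pi.single_apply]
  conv_lhs => rw [hv]
  rw [T.map_sum]
  exact Finset.sum_congr rfl fun f _ => by rw [T.map_smul_univ, smul_eq_mul]

/-- Interpolating a homogeneous Taylor term centred at x and evaluating at x leaves only the
constant term. Derivatives need no coordinates beyond expanding the multilinear form in the standard
basis. -/
lemma sum_multilinear_mul_lagrangeQ (hM : 0 < M) (q : Fin m → Fin (M / γ)) {k : ℕ} (hk : k ≤ γ)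
    (T : ContinuousMultilinearMap ℝ (fun _ : Fin k => Fin m → ℝ) ℝ) (x : Fin m → ℝ) :
    ∑ l ∈ cellGrid γ q, T (fun _ => gridPoint l - x) * lagrangeQ γ q l x
      = if k = 0 then T (fun _ => 0) else 0 := by
  simp only [multilinear_diag_eq_sum T (gridPoint _ - x), Finset.sum_mul]
  rw [Finset.sum_comm]
  have : ∀ f : Fin k → Fin m, ∑ l ∈ cellGrid γ q, (∏ s, (gridPoint l - x) (f s)) *
      T (fun s => Pi.single (f s) 1) * lagrangeQ γ q l x
      = (if k = 0 then 1 else 0) * T (fun s => Pi.single (f s) 1) := by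
    intro f
    rw [← sum_monomial_mul_lagrangeQ hM q hk f x, Finset.sum_mul]
    exact Finset.sum_congr rfl fun l _ => by simp only [Pi.sub_apply]; ring
  simp only [this]
  split_ifs with h0
  · subst h0
    simp only [one_mul, Finset.univ_unique, Finset.sum_singleton]
    congr 1
    exact Subsingleton.elim _ _
  · simp

lemma abs_sub_le_of_mem_cell {q : Fin m → Fin (M / γ)} {x y : Fin m → ℝ} (hx : x ∈ cell γ q)
    (hy : y ∈ cell γ q) (i : Fin m) : |x i - y i| ≤ (γ : ℝ) / M := by
  have h1 := hx.1 i; have h2 := hx.2 i; have h3 := hy.1 i; have h4 := hy.2 i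
  have h5 : (((q i : ℕ) : ℝ) + 1) * γ / M = ((q i : ℕ) : ℝ) * γ / M + γ / M := by ring
  simp only [h5] at h2 h4
  rw [abs_le]
  constructor <;> linarith

lemma abs_lagrangeQ_le (hγ : 1 ≤ γ) (hM : 0 < M) {q : Fin m → Fin (M / γ)} (l : Grid m M)
    {x : Fin m → ℝ} (hx : x ∈ cell γ q) :
    |lagrangeQ γ q l x| ≤ ((γ : ℝ) ^ (γ + 1)) ^ m := by
  have hM' : (0 : ℝ) < M := by exact_mod_cast hM
  have hγ' : (1 : ℝ) ≤ γ := by exact_mod_cast hγ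
  rw [lagrangeQ_eq_prod, Finset.abs_prod]
  refine (Finset.prod_le_prod (fun _ _ => abs_nonneg _) fun i _ => ?_).trans_eq
    (by simp [Finset.prod_const] : ∏ _i : Fin m, (γ : ℝ) ^ (γ + 1) = _)
  rw [lagrangeOne, Finset.abs_prod]
  refine (Finset.prod_le_prod (fun _ _ => abs_nonneg _) (g := fun _ => (γ : ℝ))
    fun j hj => ?_).trans ?_
  · obtain ⟨hj1, hj2⟩ := Finset.mem_filter.1 hj
    have hj1 := Finset.mem_range.1 hj1
    -- Each factor is at most γ: the numerator is at most γ/M within the cell, and distinct nodes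
    -- are at least 1/M apart.
    rw [abs_div, ← sub_div, abs_div, abs_of_pos hM']
    have hden : (1 : ℝ) ≤ |((l i : ℕ) : ℝ) - ((γ * (q i : ℕ) + j : ℕ) : ℝ)| := by
      have : (1 : ℤ) ≤ |((l i : ℕ) : ℤ) - ((γ * (q i : ℕ) + j : ℕ) : ℤ)| :=
        Int.one_le_abs (by omega)
      exact_mod_cast this
    have hnum : |x i - ((γ * (q i : ℕ) + j : ℕ) : ℝ) / M| ≤ (γ : ℝ) / M := by
      have h1 := hx.1 i
      have h2 := hx.2 i
      have hj' : (j : ℝ) ≤ γ := by exact_mod_cast Nat.lt_succ_iff.1 hj1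
      have e : ((γ * (q i : ℕ) + j : ℕ) : ℝ) / M = ((q i : ℕ) : ℝ) * γ / M + j / M := by
        push_cast; ring
      have h5 : (((q i : ℕ) : ℝ) + 1) * γ / M = ((q i : ℕ) : ℝ) * γ / M + γ / M := by ring
      have h6 : (j : ℝ) / M ≤ γ / M := by gcongr
      have h7 : 0 ≤ (j : ℝ) / M := by positivity
      simp only [h5] at h2
      rw [e, abs_le]
      constructor <;> linarith
    rw [div_div_eq_mul_div, div_le_iff₀ (by linarith)]
    calc _ ≤ (γ : ℝ) / M * M := by gcongr
      _ = γ * 1 := by field_simp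
      _ ≤ _ := by gcongr
  · rw [Finset.prod_const]
    refine pow_le_pow_right₀ hγ' ((Finset.card_filter_le _ _).trans ?_)
    simp

lemma eucl_le {v : Fin m → ℝ} {r : ℝ} (hr : 0 ≤ r) (h : ∀ i, |v i| ≤ r) : eucl v ≤ m * r := by
  rw [eucl, EuclideanSpace.norm_eq, Real.sqrt_le_iff]
  refine ⟨by positivity, ?_⟩
  have h1 : ∑ i, ‖(WithLp.toLp 2 v : EuclideanSpace ℝ (Fin m)) i‖ ^ 2 ≤ m * r ^ 2 := by
    refine (Finset.sum_le_card_nsmul _ _ (r ^ 2) fun i _ => ?_).trans_eq (by simp)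
    exact pow_le_pow_left₀ (norm_nonneg _) (h i) 2
  refine h1.trans ?_
  rw [mul_pow]
  gcongr
  exact_mod_cast Nat.le_self_pow two_ne_zero m

lemma cell_subset_cube (q : Fin m → Fin (M / γ)) : cell γ q ⊆ cube m := by
  intro x hx
  refine ⟨fun i => le_trans ?_ (hx.1 i), fun i => (hx.2 i).trans ?_⟩
  · simp only [Pi.zero_apply]; positivity
  · simp only [Pi.one_apply]
    refine div_le_one_of_le₀ ?_ (by positivity)
    have := cell_index_le (q i)
    have h : (((q i : ℕ) + 1) * γ : ℕ) ≤ M := by linarith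
    exact_mod_cast h

/-- The interpolation error on a cell, for values known up to `ε`. -/
lemma abs_cellPoly_sub_le (hγ : 1 ≤ γ) (hM : 0 < M) {K : ℝ} (hK : 0 ≤ K) {g : (Fin m → ℝ) → ℝ}
    (hg : HolderSmooth K (γ : ℝ) g) {v : Grid m M → ℝ} {ε : ℝ}
    (hv : ∀ l, |v l - g (gridPoint l)| ≤ ε) {q : Fin m → Fin (M / γ)} {x : Fin m → ℝ}
    (hx : x ∈ cell γ q) :
    |cellPoly γ v q x - g x| ≤ ((γ : ℝ) + 1) ^ m * ((γ : ℝ) ^ (γ + 1)) ^ m *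
      (ε + K * (m * ((γ : ℝ) / M)) ^ γ) := by
  -- The Taylor polynomial is centred at the point of evaluation rather than at a fixed point of the
  -- cell, so only the remainder bound of the smoothness condition is used, and no bound on
  -- derivatives.
  let P : (Fin m → ℝ) → ℝ := fun y => ∑ k ∈ Finset.range (γ + 1),
    (1 / (k.factorial : ℝ)) * iteratedFDerivWithin ℝ k g (cube m) x (fun _ => y - x)
  have hrepr : ∑ l ∈ cellGrid γ q, P (gridPoint l) * lagrangeQ γ q l x = g x := by
    simp only [P, Finset.sum_mul]
    rw [Finset.sum_comm]
    have : ∀ k ∈ Finset.range (γ + 1), ∑ l ∈ cellGrid γ q, (1 / (k.factorial : ℝ)) *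
        iteratedFDerivWithin ℝ k g (cube m) x (fun _ => gridPoint l - x) * lagrangeQ γ q l x
        = if k = 0 then g x else 0 := by
      intro k hk
      simp only [mul_assoc]
      rw [← Finset.mul_sum,
        sum_multilinear_mul_lagrangeQ hM q (Nat.lt_succ_iff.1 (Finset.mem_range.1 hk))]
      split_ifs with h0
      · subst h0; simp
      · simp
    rw [Finset.sum_congr rfl this]
    simp
  have hpt : ∀ l ∈ cellGrid γ q, |v l - P (gridPoint l)| ≤ ε + K * (m * ((γ : ℝ) / M)) ^ γ := by
    intro l hl
    have hlc : gridPoint l ∈ cell γ q := by simpa [cellGrid] using hl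
    have h1 := hg.2 x (cell_subset_cube q hx) (gridPoint l) (gridPoint_mem_cube l)
    rw [Nat.floor_natCast, Real.rpow_natCast] at h1
    have h2 : eucl (gridPoint l - x) ≤ m * ((γ : ℝ) / M) :=
      eucl_le (by positivity) fun i => abs_sub_le_of_mem_cell hlc hx i
    have h3 : K * eucl (gridPoint l - x) ^ γ ≤ K * (m * ((γ : ℝ) / M)) ^ γ := by
      gcongr
      exact norm_nonneg _
    calc _ ≤ |v l - g (gridPoint l)| + |g (gridPoint l) - P (gridPoint l)| := abs_sub_le _ _ _
      _ ≤ _ := add_le_add (hv l) (h1.trans h3)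
  have hdiff : cellPoly γ v q x - g x
      = ∑ l ∈ cellGrid γ q, (v l - P (gridPoint l)) * lagrangeQ γ q l x := by
    simp only [sub_mul, Finset.sum_sub_distrib, hrepr]
    rfl
  rw [hdiff]
  refine (Finset.abs_sum_le_sum_abs _ _).trans ((Finset.sum_le_card_nsmul _ _
    ((ε + K * (m * ((γ : ℝ) / M)) ^ γ) * ((γ : ℝ) ^ (γ + 1)) ^ m) fun l hl => ?_).trans_eq ?_)
  · rw [abs_mul]
    exact mul_le_mul (hpt l hl) (abs_lagrangeQ_le hγ hM l hx) (abs_nonneg _)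
      ((abs_nonneg _).trans (hpt l hl))
  · rw [nsmul_eq_mul, card_cellGrid hM]; ring

/-- Adjacent cells share faces, where several cell polynomials are added up. These faces lie in
countably many hyperplanes and do not affect the integral. -/
lemma ae_notMem_faces (m M γ : ℕ) :
    ∀ᵐ x : Fin m → ℝ, ∀ (i : Fin m) (j : ℕ), x i ≠ (j : ℝ) * γ / M := by
  rw [ae_all_iff]; intro i
  rw [ae_all_iff]; intro j
  rw [ae_iff]
  simp only [ne_eq, not_not]
  exact Measure.pi_hyperplane (fun _ : Fin m => (volume : Measure ℝ)) i ((j : ℝ) * γ / M)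

lemma eq_floor_of_mem_cell (hγ : 1 ≤ γ) (hM : 0 < M) {q : Fin m → Fin (M / γ)} {x : Fin m → ℝ}
    (hx : x ∈ cell γ q) (hf : ∀ (i : Fin m) (j : ℕ), x i ≠ (j : ℝ) * γ / M) (i : Fin m) :
    (q i : ℕ) = ⌊x i * M / γ⌋₊ := by
  have hM' : (0 : ℝ) < M := by exact_mod_cast hM
  have hγ' : (0 : ℝ) < γ := by exact_mod_cast hγ
  have h1 := hx.1 i
  have h2 := lt_of_le_of_ne (hx.2 i) (by have := hf i ((q i : ℕ) + 1); push_cast at this; exact this)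
  symm
  rw [Nat.floor_eq_iff (by
    have := (cell_subset_cube q hx).1 i
    simp only [Pi.zero_apply] at this
    positivity), le_div_iff₀ hγ', div_lt_iff₀ hγ']
  simp only [div_le_iff₀ hM', lt_div_iff₀ hM'] at h1 h2
  exact ⟨h1, h2⟩

lemma exists_mem_cell (hγ : 1 ≤ γ) (hM : 0 < M) (hdvd : γ ∣ M) {x : Fin m → ℝ} (hx : x ∈ cube m)
    (hf : ∀ (i : Fin m) (j : ℕ), x i ≠ (j : ℝ) * γ / M) :
    ∃ q : Fin m → Fin (M / γ), x ∈ cell γ q := by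
  have hM' : (0 : ℝ) < M := by exact_mod_cast hM
  have hγ' : (0 : ℝ) < γ := by exact_mod_cast hγ
  have hcast : ((M / γ : ℕ) : ℝ) * γ = M := by exact_mod_cast Nat.div_mul_cancel hdvd
  have hnn : ∀ i, 0 ≤ x i * M / γ := fun i => by
    have := hx.1 i
    simp only [Pi.zero_apply] at this
    positivity
  have hlt : ∀ i, ⌊x i * M / γ⌋₊ < M / γ := by
    intro i
    rw [Nat.floor_lt (hnn i), div_lt_iff₀ hγ', hcast]
    have h1 : x i < 1 := lt_of_le_of_ne (hx.2 i) (by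
      have := hf i (M / γ)
      rw [hcast, div_self hM'.ne'] at this
      exact this)
    nlinarith
  refine ⟨fun i => ⟨⌊x i * M / γ⌋₊, hlt i⟩, fun i => ?_, fun i => ?_⟩
  · have := Nat.floor_le (hnn i)
    rw [le_div_iff₀ hγ'] at this
    simp only [div_le_iff₀ hM']
    exact this
  · have := (Nat.lt_floor_add_one (x i * M / γ)).le
    rw [div_le_iff₀ hγ'] at this
    simp only [le_div_iff₀ hM']
    exact this

lemma interpolate_eq_cellPoly (hγ : 1 ≤ γ) (hM : 0 < M) (v : Grid m M → ℝ)
    {q : Fin m → Fin (M / γ)} {x : Fin m → ℝ} (hx : x ∈ cell γ q)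
    (hf : ∀ (i : Fin m) (j : ℕ), x i ≠ (j : ℝ) * γ / M) :
    interpolate γ v x = cellPoly γ v q x := by
  rw [interpolate, Finset.sum_eq_single q, indicator_of_mem hx]
  · intro q' _ hq'
    refine indicator_of_notMem (fun hx' => hq' ?_) _
    funext i
    exact Fin.ext ((eq_floor_of_mem_cell hγ hM hx' hf i).trans
      (eq_floor_of_mem_cell hγ hM hx hf i).symm)
  · simp

lemma l1Dist_interpolate_le (hγ : 1 ≤ γ) (hM : 0 < M) (hdvd : γ ∣ M) {K : ℝ} (hK : 0 ≤ K)
    {g : (Fin m → ℝ) → ℝ} (hg : HolderSmooth K (γ : ℝ) g) {v : Grid m M → ℝ} {ε : ℝ}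
    (hv : ∀ l, |v l - g (gridPoint l)| ≤ ε) :
    l1Dist (interpolate γ v) g ≤ ENNReal.ofReal (((γ : ℝ) + 1) ^ m * ((γ : ℝ) ^ (γ + 1)) ^ m *
      (ε + K * (m * ((γ : ℝ) / M)) ^ γ)) := by
  have hvol : volume (cube m) = 1 := by
    rw [cube, Real.volume_Icc_pi]; simp
  rw [l1Dist, ← mul_one (ENNReal.ofReal _), ← hvol, ← setLIntegral_const]
  refine lintegral_mono_ae ?_
  have hcube : MeasurableSet (cube m) := measurableSet_Icc
  filter_upwards [ae_restrict_mem hcube, ae_restrict_of_ae (ae_notMem_faces m M γ)] with x hx hf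
  obtain ⟨q, hq⟩ := exists_mem_cell hγ hM hdvd hx hf
  rw [interpolate_eq_cellPoly hγ hM v hq hf]
  exact ENNReal.ofReal_le_ofReal (abs_cellPoly_sub_le hγ hM hK hg hv hq)

end

/-! ## The algorithm for smooth boundary fragments -/

/-- Turns the mesh condition into the form in which the Taylor remainder appears, linear in ε. -/
lemma pow_mesh_le {a ε : ℝ} (ha : 0 < a) (hε : 0 < ε) {γ M : ℕ} (hγ : 1 ≤ γ)
    (hM : a * ε ^ (-(1 : ℝ) / (γ : ℝ)) ≤ (M : ℝ)) {r : ℝ} (hr : 0 ≤ r) :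
    0 < M ∧ (r / M) ^ γ ≤ (r / a) ^ γ * ε := by
  have hp : 0 < a * ε ^ (-(1 : ℝ) / (γ : ℝ)) := by positivity
  have hM0 : (0 : ℝ) < M := hp.trans_le hM
  refine ⟨by exact_mod_cast hM0, ?_⟩
  have hγ0 : (γ : ℝ) ≠ 0 := by exact_mod_cast (by omega : γ ≠ 0)
  have hpow : (ε ^ (-(1 : ℝ) / (γ : ℝ))) ^ γ = ε⁻¹ := by
    rw [← Real.rpow_natCast, ← Real.rpow_mul hε.le, div_mul_cancel₀ _ hγ0, Real.rpow_neg_one]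
  calc (r / M) ^ γ ≤ (r / (a * ε ^ (-(1 : ℝ) / (γ : ℝ)))) ^ γ := by gcongr
    _ = (r / a) ^ γ * ε := by
        rw [← div_div, div_pow (r / a), hpow, div_inv_eq_mul]

lemma outputWithin_of_smoothBoundary {m : ℕ} {γ : ℕ} (hγ : 1 ≤ γ) {K : ℝ} (hK : 0 ≤ K) {D₀ D₁ : ℝ}
    (h0 : UniformBernstein D₀) (h1 : UniformEmpiricalBernstein D₁) {ε δ : ℝ} (hε : 0 < ε)
    (hδ : 0 < δ) (hδ1 : δ < 1) {M : ℕ} (hM : 0 < M) (hdvd : γ ∣ M) {g : (Fin m → ℝ) → ℝ}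
    (hg : SmoothBoundary K (γ : ℝ) g) {L : Labeler m} (hL : LabelerCondition g L) {η : ℝ}
    (hη : ((γ : ℝ) + 1) ^ m * ((γ : ℝ) ^ (γ + 1)) ^ m * (ε + K * (m * ((γ : ℝ) / M)) ^ γ) ≤ η) :
    OutputWithin D₀ D₁ γ M ε δ L g η := by
  refine ofReal_le_measure_all_lines hL h0 h1 hε hδ hδ1 hg.2 fun ω hω h hh => ?_
  simp only [learnBoundary] at hh
  split_ifs at hh with hrun
  rw [← Option.some.inj hh]
  refine (l1Dist_interpolate_le hγ hM hdvd hK hg.1 fun l => ?_).trans (ENNReal.ofReal_le_ofReal hη)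
  by_contra hcon
  exact hω l ⟨_, (Option.some_get (hrun l)).symm, not_le.1 hcon⟩

end

end AbstainingLabeler

open AbstainingLabeler
theorem mainTheorem7 (d : ℕ) (hd : 2 ≤ d) (γ : ℕ) (hγ : 1 ≤ γ) (K : ℝ) (hK : 0 ≤ K) :
    -- the absolute constants of the two tests exist
    (∃ D₀ : ℝ, UniformBernstein D₀) ∧ (∃ D₁ : ℝ, UniformEmpiricalBernstein D₁) ∧
    -- precision `ε` on the lines and `M ≥ a ε^(-1/γ)`: the error is `O(ε)`
    (∀ a : ℝ, 0 < a → ∃ C : ℝ, 0 < C ∧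
      ∀ D₀ D₁ : ℝ, UniformBernstein D₀ → UniformEmpiricalBernstein D₁ →
      ∀ ε δ : ℝ, 0 < ε → ε ≤ 1 / 2 → 0 < δ → δ < 1 →
      ∀ M : ℕ, γ ∣ M → a * ε ^ (-(1 : ℝ) / (γ : ℝ)) ≤ (M : ℝ) →
      ∀ gstar : (Fin (d - 1) → ℝ) → ℝ, SmoothBoundary K (γ : ℝ) gstar →
      ∀ L : Labeler (d - 1), LabelerCondition gstar L →
        OutputWithin D₀ D₁ γ M ε δ L gstar (C * ε)) ∧
    -- the constants can be chosen such that the error is at most `ε`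
    (∃ c a : ℝ, 0 < c ∧ c ≤ 1 ∧ 0 < a ∧
      ∀ D₀ D₁ : ℝ, UniformBernstein D₀ → UniformEmpiricalBernstein D₁ →
      ∀ ε δ : ℝ, 0 < ε → ε ≤ 1 / 2 → 0 < δ → δ < 1 →
      ∀ M : ℕ, γ ∣ M → a * ε ^ (-(1 : ℝ) / (γ : ℝ)) ≤ (M : ℝ) →
      ∀ gstar : (Fin (d - 1) → ℝ) → ℝ, SmoothBoundary K (γ : ℝ) gstar →
      ∀ L : Labeler (d - 1), LabelerCondition gstar L →
        OutputWithin D₀ D₁ γ M (c * ε) δ L gstar ε) := by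
  have hγ' : (1 : ℝ) ≤ γ := by exact_mod_cast hγ
  have hB1 : (1 : ℝ) ≤ ((γ : ℝ) + 1) ^ (d - 1) * ((γ : ℝ) ^ (γ + 1)) ^ (d - 1) :=
    one_le_mul_of_one_le_of_one_le (one_le_pow₀ (by linarith)) (one_le_pow₀ (one_le_pow₀ hγ'))
  set B : ℝ := ((γ : ℝ) + 1) ^ (d - 1) * ((γ : ℝ) ^ (γ + 1)) ^ (d - 1) with hB
  let r : ℝ := ((d - 1 : ℕ) : ℝ) * γ
  have hr : 0 ≤ r := by positivity
  have hmesh : ∀ M : ℕ, ((d - 1 : ℕ) : ℝ) * ((γ : ℝ) / M) = r / M := fun M => by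
    simp only [r]; ring
  refine ⟨exists_uniformBernstein, exists_uniformEmpiricalBernstein, fun a ha => ?_, ?_⟩
  · refine ⟨B * (1 + K * (r / a) ^ γ), by positivity, ?_⟩
    intro D₀ D₁ h0 h1 ε δ hε _ hδ hδ1 M hdvd hM g hg L hL
    obtain ⟨hM0, hle⟩ := pow_mesh_le ha hε hγ hM hr
    refine outputWithin_of_smoothBoundary hγ hK h0 h1 hε hδ hδ1 hM0 hdvd hg hL ?_
    rw [← hB, hmesh]
    calc B * (ε + K * (r / M) ^ γ) ≤ B * (ε + K * ((r / a) ^ γ * ε)) := by gcongr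
      _ = _ := by ring
  -- The line errors contribute B c ε = ε/2. Since 1 ≤ a ≤ a^γ, the remainder contributes at most B
  -- K r^γ ε / a ≤ ε/2.
  · refine ⟨1 / (2 * B), 1 + 2 * B * K * r ^ γ, by positivity, ?_, by positivity, ?_⟩
    · rw [div_le_one (by positivity)]; linarith
    intro D₀ D₁ h0 h1 ε δ hε _ hδ hδ1 M hdvd hM g hg L hL
    set a : ℝ := 1 + 2 * B * K * r ^ γ with ha
    have hnn : 0 ≤ 2 * B * K * r ^ γ := by positivity
    have ha1 : 1 ≤ a := by linarith
    obtain ⟨hM0, hle⟩ := pow_mesh_le (by linarith) hε hγ hM hr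
    refine outputWithin_of_smoothBoundary hγ hK h0 h1 (by positivity) hδ hδ1 hM0 hdvd hg hL ?_
    rw [← hB, hmesh]
    have hapow : a ≤ a ^ γ := le_self_pow₀ ha1 (by omega)
    have hkey : B * K * (r / a) ^ γ ≤ 1 / 2 := by
      rw [div_pow, mul_div_assoc', div_le_iff₀ (by positivity)]
      linarith
    calc B * (1 / (2 * B) * ε + K * (r / M) ^ γ)
        ≤ B * (1 / (2 * B) * ε + K * ((r / a) ^ γ * ε)) := by gcongr
      _ = ε / 2 + (B * K * (r / a) ^ γ) * ε := by field_simp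
      _ ≤ ε / 2 + 1 / 2 * ε := by gcongr
      _ = ε := by ring
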